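/- \textbf{Setting.} Let $H=(V,E)$ be a finite hypergraph on $n$ vertices with at most $m$ hyperedges (repeated hyperedges are allowed), each having at least two vertices and arity in $[r,2r]$, where $r\ge 1$. Its multigraph $G=\Phi(H)$ is obtained by replacing every hyperedge $e$ by a clique $K_e$ on its vertices, parallel edges coming from different hyperedges being kept apart. A \emph{weight assignment} $W$ of $G$ gives each multi-edge a nonnegative weight such that, for every $e\in E$, the weights of the multi-edges of $K_e$ sum to $1$; $G(W)$ is $G$ with these edge weights. For a multigraph with edge weights $w$, the effective resistance $R(u,v)\in[0,\infty]$ between $u\neq v$ is the reciprocal of $\min\{\sum_{(a,b)} w(a,b)(x_a-x_b)^2 : x\in\mathbb{R}^V,\ x_u=1,\ x_v=0\}$ (so $R(u,v)=\infty$ if $u,v$ are not connected), and $R(u,u)=0$. For $\lambda>0$ and an integer $T\geq 0$, the procedure $\mathtt{VS}(H,\lambda)$ with $T$ rounds starts with $F=\emptyset$ and repeats $T$ times, with fresh randomness: keep every vertex independently with probability $1/r$, obtaining $V'$, and let $H'$ be the hypergraph with the hyperedges $e\cap V'$, where $e$ runs over the hyperedges that are still in $H$ (with multiplicity); sample each multi-edge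 $(u,v)$ of the unweighted multigraph $\Phi(H')$ independently with probability $\min\{1,\lambda R^{\Phi(H')}(u,v)\}$; add to $F$, and delete from $H$, all hyperedges of which at least one multi-edge got sampled. The output is $F$. \textbf{Theorem (Key Technical Theorem).} For every $c\in\mathbb{N}$ there are $C>0$ and $K\in\mathbb{N}$, depending only on $c$, such that the following holds with $p(n,m)=C\,(\log(nm))^K$. For every $\theta\in(0,1)$ and all $r,n,m,H$ as above, there is a single weight assignment $W^*$ of $G=\Phi(H)$ such that every hyperedge $e\in E$ satisfies at least one of the following: \begin{enumerate} \item[(a)] $\max_{u,v\in e} R^{G(W^*)}(u,v)\le\theta$; \item[(b)] $\Pr[e\in\mathtt{VS}(H,\lambda)]\ge 1-(nm)^{-c}$, where $\mathtt{VS}$ is run with $\lambda=\theta^{-1}p(n,m)$ for $r\lceil p(n,m)\rceil$ rounds. \end{enumerate} -/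

import Mathlib

open scoped NNReal ENNReal

noncomputable section

/-- A finite hypergraph on the vertex type `V` whose hyperedges carry names from `E`: `edges` is the
set of names that are present and `verts e` is the set of vertices of the hyperedge named `e`
(irrelevant if `e ∉ edges`).  The names keep distinct hyperedges apart when their vertex sets
coincide, as happens after a projection to a subset of the vertices.  A hypergraph without repeated
hyperedges is the case in which `verts` is injective on `edges`. -/
structure NamedHypergraph (V E : Type*) where
  edges : Finset E
  verts : E → Finset V

namespace NamedHypergraph

variable {V E : Type*} [DecidableEq V] [DecidableEq E]

/-- The hypergraph induced by a set `V'` of vertices: every hyperedge `e` becomes `e ∩ V'`.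
The vertices outside `V'` remain in the type `V`, where they are isolated. -/
def project (H : NamedHypergraph V E) (V' : Finset V) : NamedHypergraph V E where
  edges := H.edges
  verts := fun e => H.verts e ∩ V'

/-- Deletion of a set of hyperedges. -/
def delete (H : NamedHypergraph V E) (F : Finset E) : NamedHypergraph V E where
  edges := H.edges \ F
  verts := H.verts

/-- The edges of the complete graph on the vertex set `s`: all pairs of distinct elements of `s`. -/
def clique (s : Finset V) : Finset (Sym2 V) :=
  s.sym2.filter fun p => ¬ p.IsDiag

/-- The multigraph of a hypergraph: every hyperedge is replaced by a clique on its vertices.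
The multi-edge `(e, s(u, v))` is the copy of the edge `uv` that comes from the hyperedge `e`. -/
def multigraph (H : NamedHypergraph V E) : Finset (E × Sym2 V) :=
  H.edges.biUnion fun e => (clique (H.verts e)).image fun p => (e, p)

/-- `W` is a weight assignment of the multigraph of `H`: nonnegative weights of the multi-edges such
that, for every hyperedge, the weights of the multi-edges of its clique add up to `1`. -/
def IsWeightAssignment (H : NamedHypergraph V E) (W : E × Sym2 V → ℝ≥0) : Prop :=
  ∀ e ∈ H.edges, ∑ p ∈ clique (H.verts e), W (e, p) = 1

end NamedHypergraph

/-- The squared potential difference `(x a - x b) ^ 2` across the pair `s(a, b)`. -/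
def sqDiff {V : Type*} (x : V → ℝ) : Sym2 V → ℝ :=
  Sym2.lift ⟨fun a b => (x a - x b) ^ 2, fun a b => by ring⟩

/-- The energy `∑ w(a, b) (x a - x b) ^ 2` of the vertex potentials `x` in the multigraph `G` with
edge weights `w`. -/
def energy {V E : Type*} (G : Finset (E × Sym2 V)) (w : E × Sym2 V → ℝ≥0) (x : V → ℝ) : ℝ :=
  ∑ f ∈ G, (w f : ℝ) * sqDiff x f.2

/-- The effective resistance between `u` and `v` in the multigraph `G` with edge weights
(conductances) `w`: the reciprocal of the minimum energy of vertex potentials that are `1` at `u`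
and `0` at `v`.  It is `∞` if `u` and `v` are not connected, and `0` if `u = v`. -/
def effRes {V E : Type*} (G : Finset (E × Sym2 V)) (w : E × Sym2 V → ℝ≥0) (u v : V) : ℝ≥0∞ :=
  (⨅ (x : V → ℝ) (_ : x u = 1 ∧ x v = 0), ENNReal.ofReal (energy G w x))⁻¹

theorem energy_one_sub {V E : Type*} (G : Finset (E × Sym2 V)) (w : E × Sym2 V → ℝ≥0)
    (x : V → ℝ) : energy G w (fun a => 1 - x a) = energy G w x := by
  refine Finset.sum_congr rfl fun f _ => ?_
  obtain ⟨e, p⟩ := f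
  induction p using Sym2.ind with
  | _ a b => simp only [sqDiff, Sym2.lift_mk]; ring

theorem effRes_le_swap {V E : Type*} (G : Finset (E × Sym2 V)) (w : E × Sym2 V → ℝ≥0) (u v : V) :
    effRes G w u v ≤ effRes G w v u := by
  refine ENNReal.inv_le_inv.2 (le_iInf₂ fun x hx => ?_)
  refine iInf₂_le_of_le (fun a => 1 - x a) (by simp [hx.1, hx.2]) ?_
  rw [energy_one_sub]

theorem effRes_comm {V E : Type*} (G : Finset (E × Sym2 V)) (w : E × Sym2 V → ℝ≥0) (u v : V) :
    effRes G w u v = effRes G w v u :=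
  le_antisymm (effRes_le_swap G w u v) (effRes_le_swap G w v u)

/-- The effective resistance between the two ends of an unordered pair. -/
def pairRes {V E : Type*} (G : Finset (E × Sym2 V)) (w : E × Sym2 V → ℝ≥0) : Sym2 V → ℝ≥0∞ :=
  Sym2.lift ⟨fun u v => effRes G w u v, fun u v => effRes_comm G w u v⟩

/-- The random subset of a finite type that contains each element `i`, independently, with
probability `min 1 (p i)`. -/
def randomSubset {ι : Type*} [Fintype ι] [DecidableEq ι] (p : ι → ℝ≥0∞) : PMF (Finset ι) :=
  PMF.ofFintype (fun S => (∏ i ∈ S, min 1 (p i)) * ∏ i ∈ Finset.univ \ S, (1 - min 1 (p i))) <| by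
    have h := Finset.prod_add (fun i => min 1 (p i)) (fun i => 1 - min 1 (p i)) Finset.univ
    rw [Finset.powerset_univ] at h
    rw [← h]
    refine Finset.prod_eq_one fun i _ => ?_
    exact add_tsub_cancel_of_le (min_le_left _ _)

/-- One round of vertex sampling.  Keep every vertex independently with probability `1 / r`; then
sample every multi-edge of the (unweighted) multigraph of the projected hypergraph independently
with probability `min 1 (lam * R)`, where `R` is the effective resistance between its ends.
The outcome is the set of the hyperedges of which at least one multi-edge got sampled. -/
def vsRound {V E : Type*} [Fintype V] [DecidableEq V] [Fintype E] [DecidableEq E]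
    (r : ℕ) (lam : ℝ≥0∞) (H : NamedHypergraph V E) : PMF (Finset E) :=
  (randomSubset fun _ : V => (r : ℝ≥0∞)⁻¹).bind fun V' =>
    (randomSubset fun f : E × Sym2 V =>
      if f ∈ (H.project V').multigraph then
        lam * pairRes (H.project V').multigraph (fun _ => 1) f.2
      else 0).map fun M => M.image Prod.fst

/-- The random output of the vertex-sampling procedure run for a given number of rounds: the
hyperedges found in a round are added to the output and deleted from the hypergraph before the next
round, which uses fresh randomness. -/
def vertexSampling {V E : Type*} [Fintype V] [DecidableEq V] [Fintype E] [DecidableEq E]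
    (r : ℕ) (lam : ℝ≥0∞) : ℕ → NamedHypergraph V E → PMF (Finset E)
  | 0, _ => PMF.pure ∅
  | rounds + 1, H => (vsRound r lam H).bind fun F' =>
      (vertexSampling r lam rounds (H.delete F')).map fun F => F' ∪ F

/-- The polylogarithmic function `C * (log (n * m)) ^ K`. -/
def polylog (C : ℝ) (K n m : ℕ) : ℝ :=
  C * Real.log ((n : ℝ) * m) ^ K

end

/-!
The weight assignment is explicit, and the deletions of `VS` are replaced by a deterministic
schedule.

**Schedule.** The *exposure* of a hyperedge is the sum of its probabilities of being found in the
rounds so far, each round being run on the hyperedges whose exposure is still below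
`L = (c + 1) log (n m)`.  Deleting hyperedges increases effective resistances, so a hyperedge is
found at least as often in the random process as in the schedule as long as the random process has
kept nothing that the schedule has deleted.  The supermartingale `∑ exp (exposure - L)`
(`prob_missed_le`) shows that every hyperedge deleted by the schedule is found with probability at
least `1 - m exp (-L)`.  These are the hyperedges of alternative (b).

**Weights.** For a hyperedge `g` and `u ∈ g` let `A g u` be the probability, summed over the
schedule, that `u` is kept and `g` is found (with a bounded number of vertices of `g` kept).  Since
the total exposure is at most `L + 1`, the sum of `A g u` over `u ∈ g` is `O(L)`.  The weight of
`ab` in `g` is proportional to `1 / r ^ 2` plus a multiple of `(A g a + A g b) / r`.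

**Surviving hyperedges have small resistance.** By `effRes_le_of_half_separated` it suffices that
every potential `σ` separating a vertex `u` of a surviving `e` from half of `e` has energy at least
`4 / θ`.  In at least half of the rounds `e` is found with probability below `1 / (8 r)`.  With
probability of order `1 / r` the vertex `u` and some vertex of the separated half are kept, and then
the effective resistance between them is at least the reciprocal of the energy of `σ` in the
projected multigraph (`le_starCatch`).  Hence this energy is large in expectation.  The expectation
consists of the *spread energy* (all pairs, conductance `1 / r ^ 2`) and the *star energy* (pairs at
`u`, conductance `1 / r`, because `u` is known to be kept).  If the spread energy is large, the
uniform part of the weights suffices.  Otherwise (`spread_or_star_of_rarely_found`) truncate `σ` at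
a level between two consecutive ones at which the star energy changes by at most a constant factor:
the total energy is then `O(N)`, where `N` hyperedges at `u` reach with half of their vertices
beyond the level, for a hyperedge reaching there with few vertices pays for it in spread energy.
Each of these `N` hyperedges is therefore found at `u` with probability of order `λ / (r N)` up to
logarithms, so together they contribute order `λ / r` to the star energy weighted with `A`,
whatever `N` is, in each of at least half of the rounds.
-/

/-! ### Probabilities of events as real numbers -/

/-- The probability of the event `s` under `μ`, as a real number. -/
noncomputable def prob {α : Type*} (μ : PMF α) (s : Set α) : ℝ :=
  (μ.toOuterMeasure s).toReal

section prob

variable {α β : Type*}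

theorem toOuterMeasure_le_one (μ : PMF α) (s : Set α) : μ.toOuterMeasure s ≤ 1 := by
  rw [PMF.toOuterMeasure_apply, ← μ.tsum_coe]
  exact ENNReal.tsum_le_tsum fun a => Set.indicator_le_self _ _ _

theorem prob_nonneg (μ : PMF α) (s : Set α) : 0 ≤ prob μ s := ENNReal.toReal_nonneg

theorem prob_le_one (μ : PMF α) (s : Set α) : prob μ s ≤ 1 :=
  ENNReal.toReal_le_of_le_ofReal zero_le_one (by simpa using toOuterMeasure_le_one μ s)

theorem prob_compl (μ : PMF α) (s : Set α) : prob μ sᶜ = 1 - prob μ s := by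
  have h : μ.toOuterMeasure s + μ.toOuterMeasure sᶜ = 1 := by
    rw [PMF.toOuterMeasure_apply, PMF.toOuterMeasure_apply, ← ENNReal.tsum_add, ← μ.tsum_coe]
    exact tsum_congr fun a => Set.indicator_self_add_compl_apply s μ a
  have h1 := congrArg ENNReal.toReal h
  rw [ENNReal.toReal_add (ne_top_of_le_ne_top ENNReal.one_ne_top (toOuterMeasure_le_one μ _))
    (ne_top_of_le_ne_top ENNReal.one_ne_top (toOuterMeasure_le_one μ _))] at h1
  simp only [prob]
  simp at h1
  linarith

theorem prob_bind [Fintype α] (μ : PMF α) (f : α → PMF β) (s : Set β) :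
    prob (μ.bind f) s = ∑ a, (μ a).toReal * prob (f a) s := by
  rw [prob, PMF.toOuterMeasure_bind_apply, tsum_fintype, ENNReal.toReal_sum]
  · simp [prob]
  · exact fun a _ => ENNReal.mul_ne_top (μ.apply_ne_top a)
      (ne_top_of_le_ne_top ENNReal.one_ne_top (toOuterMeasure_le_one _ _))

theorem prob_map (μ : PMF α) (f : α → β) (s : Set β) :
    prob (μ.map f) s = prob μ (f ⁻¹' s) := by
  rw [prob, PMF.toOuterMeasure_map_apply, prob]

theorem prob_fintype [Fintype α] (μ : PMF α) (s : Set α) [DecidablePred (· ∈ s)] :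
    prob μ s = ∑ a, (μ a).toReal * if a ∈ s then 1 else 0 := by
  rw [prob, PMF.toOuterMeasure_apply_fintype, ENNReal.toReal_sum]
  · refine Finset.sum_congr rfl fun a _ => ?_
    by_cases h : a ∈ s <;> simp [h]
  · intro a _
    by_cases h : a ∈ s <;> simp [h, μ.apply_ne_top]

end prob

/-! ### Independent random subsets -/

/-- In a product of independent choices, the elements of `A` are all chosen and those of `B` are
all rejected with the product of the corresponding probabilities. -/
theorem sum_prod_subset_disjoint {ι : Type*} [Fintype ι] [DecidableEq ι] (a b : ι → ℝ)
    (hab : ∀ i, a i + b i = 1) {A B : Finset ι} (hAB : Disjoint A B) :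
    ∑ S : Finset ι, ((∏ i ∈ S, a i) * ∏ i ∈ Finset.univ \ S, b i) *
      (if A ⊆ S ∧ Disjoint S B then 1 else 0) = (∏ i ∈ A, a i) * ∏ i ∈ B, b i := by
  have h := Finset.prod_add (fun i => if i ∈ B then 0 else a i)
    (fun i => if i ∈ A then 0 else b i) Finset.univ
  rw [Finset.powerset_univ] at h
  have hl : ∏ i, ((if i ∈ B then 0 else a i) + (if i ∈ A then 0 else b i))
      = (∏ i ∈ A, a i) * ∏ i ∈ B, b i := by
    have : ∏ i ∈ A ∪ B, (if i ∈ A then a i else b i)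
        = ∏ i, ((if i ∈ B then 0 else a i) + (if i ∈ A then 0 else b i)) := by
      rw [← Finset.prod_subset (Finset.subset_univ (A ∪ B))]
      · refine Finset.prod_congr rfl fun i hi => ?_
        by_cases hA : i ∈ A
        · simp [hA, Finset.disjoint_left.1 hAB hA]
        · have hB : i ∈ B := by simpa [hA] using hi
          simp [hA, hB]
      · intro i _ hi
        simp only [Finset.mem_union, not_or] at hi
        simp [hi.1, hi.2, hab]
    rw [← this, Finset.prod_union hAB]
    congr 1
    · rw [Finset.prod_congr rfl fun i hi => if_pos hi]
    · rw [Finset.prod_congr rfl fun i hi => if_neg (Finset.disjoint_right.1 hAB hi)]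
  rw [← hl, h]
  refine Finset.sum_congr rfl fun S _ => ?_
  split_ifs with hS
  · rw [mul_one]
    congr 1
    · exact Finset.prod_congr rfl fun i hi => (if_neg (Finset.disjoint_left.1 hS.2 hi)).symm
    · refine Finset.prod_congr rfl fun i hi => (if_neg fun hA => ?_).symm
      exact (Finset.mem_sdiff.1 hi).2 (hS.1 hA)
  · rw [mul_zero, eq_comm]
    rcases not_and_or.1 hS with h1 | h1
    · obtain ⟨i, hA, hi⟩ := Finset.not_subset.1 h1
      rw [Finset.prod_eq_zero (i := i) (s := Finset.univ \ S) (by simp [hi]) (by simp [hA]),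
        mul_zero]
    · obtain ⟨i, hi, hB⟩ := Finset.not_disjoint_iff.1 h1
      rw [Finset.prod_eq_zero (i := i) (s := S) hi (by simp [hB]), zero_mul]

theorem toReal_min_one_le (x : ℝ≥0∞) : (min 1 x).toReal ≤ 1 :=
  ENNReal.toReal_le_of_le_ofReal zero_le_one (by simp)

theorem toReal_min_one_mono {x y : ℝ≥0∞} (h : x ≤ y) :
    (min 1 x).toReal ≤ (min 1 y).toReal :=
  ENNReal.toReal_mono (ne_top_of_le_ne_top ENNReal.one_ne_top (min_le_left _ _))
    (min_le_min_left _ h)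

section randomSubset

variable {ι : Type*} [Fintype ι] [DecidableEq ι]

theorem randomSubset_toReal (p : ι → ℝ≥0∞) (S : Finset ι) :
    (randomSubset p S).toReal =
      (∏ i ∈ S, (min 1 (p i)).toReal) * ∏ i ∈ Finset.univ \ S, (1 - (min 1 (p i)).toReal) := by
  rw [randomSubset, PMF.ofFintype_apply, ENNReal.toReal_mul, ENNReal.toReal_prod,
    ENNReal.toReal_prod]
  congr 1
  refine Finset.prod_congr rfl fun i _ => ?_
  rw [ENNReal.toReal_sub_of_le (min_le_left _ _) ENNReal.one_ne_top, ENNReal.toReal_one]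

theorem randomSubset_sum (p : ι → ℝ≥0∞) {A B : Finset ι} (hAB : Disjoint A B) :
    ∑ S, (randomSubset p S).toReal * (if A ⊆ S ∧ Disjoint S B then 1 else 0) =
      (∏ i ∈ A, (min 1 (p i)).toReal) * ∏ i ∈ B, (1 - (min 1 (p i)).toReal) := by
  simp_rw [randomSubset_toReal]
  exact sum_prod_subset_disjoint _ _ (fun i => by ring) hAB

theorem prob_randomSubset_meets (p : ι → ℝ≥0∞) (B : Finset ι) :
    prob (randomSubset p) {S | ¬ Disjoint S B} =
      1 - ∏ i ∈ B, (1 - (min 1 (p i)).toReal) := by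
  classical
  have h : {S | ¬ Disjoint S B} = {S | Disjoint S B}ᶜ := rfl
  rw [h, prob_compl, prob_fintype]
  have h2 := randomSubset_sum p (Finset.disjoint_empty_left B)
  simp only [Finset.empty_subset, true_and, Finset.prod_empty, one_mul] at h2
  rw [← h2]
  rfl

end randomSubset

/-- The probability that `V'` is the set of the vertices that are kept, when every vertex is kept
with probability `1 / r`. -/
noncomputable def vertexWeight {V : Type*} [Fintype V] [DecidableEq V] (r : ℕ)
    (V' : Finset V) : ℝ :=
  (randomSubset (fun _ : V => (r : ℝ≥0∞)⁻¹) V').toReal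

section vertexWeight

variable {V : Type*} [Fintype V] [DecidableEq V] {r : ℕ}

theorem vertexWeight_nonneg (V' : Finset V) : 0 ≤ vertexWeight r V' := ENNReal.toReal_nonneg

theorem vertexWeight_sum (hr : 1 ≤ r) {A B : Finset V} (hAB : Disjoint A B) :
    ∑ V', vertexWeight r V' * (if A ⊆ V' ∧ Disjoint V' B then 1 else 0) =
      (r : ℝ)⁻¹ ^ A.card * (1 - (r : ℝ)⁻¹) ^ B.card := by
  have h := randomSubset_sum (fun _ : V => (r : ℝ≥0∞)⁻¹) hAB
  have h1 : (min 1 (r : ℝ≥0∞)⁻¹).toReal = (r : ℝ)⁻¹ := by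
    rw [min_eq_right (ENNReal.inv_le_one.2 (by exact_mod_cast hr))]
    simp
  simp only [h1, Finset.prod_const] at h
  exact h

theorem vertexWeight_sum_subset (hr : 1 ≤ r) (A : Finset V) :
    ∑ V', vertexWeight r V' * (if A ⊆ V' then 1 else 0) = (r : ℝ)⁻¹ ^ A.card := by
  have h := vertexWeight_sum hr (Finset.disjoint_empty_right A)
  simpa using h

end vertexWeight

/-! ### Energies of potentials -/

section potentials

variable {V E : Type*}

@[simp] theorem sqDiff_mk (x : V → ℝ) (a b : V) : sqDiff x s(a, b) = (x a - x b) ^ 2 := rfl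

theorem sqDiff_nonneg (x : V → ℝ) (p : Sym2 V) : 0 ≤ sqDiff x p := by
  induction p using Sym2.ind with
  | _ a b => exact sq_nonneg _

theorem energy_nonneg (G : Finset (E × Sym2 V)) (w : E × Sym2 V → ℝ≥0) (x : V → ℝ) :
    0 ≤ energy G w x :=
  Finset.sum_nonneg fun f _ => mul_nonneg (w f).2 (sqDiff_nonneg x f.2)

theorem energy_mono_graph {G G' : Finset (E × Sym2 V)} (h : G ⊆ G') (w : E × Sym2 V → ℝ≥0)
    (x : V → ℝ) : energy G w x ≤ energy G' w x :=
  Finset.sum_le_sum_of_subset_of_nonneg h fun f _ _ => mul_nonneg (w f).2 (sqDiff_nonneg x f.2)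

/-- If `x` contracts the differences of `y` up to the factor `c`, its energy is at most `c ^ 2`
times that of `y`. -/
theorem energy_le_of_contracts (G : Finset (E × Sym2 V)) (w : E × Sym2 V → ℝ≥0) {x y : V → ℝ}
    {c : ℝ} (h : ∀ a b, |x a - x b| ≤ c * |y a - y b|) :
    energy G w x ≤ c ^ 2 * energy G w y := by
  rw [energy, energy, Finset.mul_sum]
  refine Finset.sum_le_sum fun f _ => ?_
  have : sqDiff x f.2 ≤ c ^ 2 * sqDiff y f.2 := by
    induction f.2 using Sym2.ind with
    | _ a b =>
      have h1 := pow_le_pow_left₀ (abs_nonneg _) (h a b) 2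
      rw [mul_pow, sq_abs, sq_abs] at h1
      exact h1
  calc (w f : ℝ) * sqDiff x f.2 ≤ (w f : ℝ) * (c ^ 2 * sqDiff y f.2) :=
        mul_le_mul_of_nonneg_left this (w f).2
    _ = _ := by ring

/-! ### Bounds on effective resistances by test potentials -/

theorem effRes_anti {G G' : Finset (E × Sym2 V)} (h : G ⊆ G') (w : E × Sym2 V → ℝ≥0) (u v : V) :
    effRes G' w u v ≤ effRes G w u v :=
  ENNReal.inv_le_inv.2 <| iInf₂_mono fun x _ => ENNReal.ofReal_le_ofReal (energy_mono_graph h w x)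

theorem pairRes_anti {G G' : Finset (E × Sym2 V)} (h : G ⊆ G') (w : E × Sym2 V → ℝ≥0)
    (p : Sym2 V) : pairRes G' w p ≤ pairRes G w p := by
  induction p using Sym2.ind with
  | _ a b => exact effRes_anti h w a b

theorem le_effRes {G : Finset (E × Sym2 V)} {w : E × Sym2 V → ℝ≥0} {u v : V} (x : V → ℝ)
    {δ Φ : ℝ} (hδ : 0 < δ) (hΦ : 0 < Φ) (hx : δ ≤ |x u - x v|) (hE : energy G w x ≤ Φ) :
    ENNReal.ofReal (δ ^ 2 / Φ) ≤ effRes G w u v := by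
  have hd : 0 < |x u - x v| := hδ.trans_le hx
  have hne : x u - x v ≠ 0 := abs_pos.1 hd
  rw [effRes, ENNReal.le_inv_iff_le_inv, ← ENNReal.ofReal_inv_of_pos (by positivity)]
  refine iInf₂_le_of_le (fun a => (x a - x v) / (x u - x v)) ⟨by simp [hne], by simp⟩ ?_
  refine ENNReal.ofReal_le_ofReal ?_
  have h1 := energy_le_of_contracts G w (x := fun a => (x a - x v) / (x u - x v)) (y := x)
    (c := δ⁻¹) (fun a b => by
      rw [← sub_div, abs_div, sub_sub_sub_cancel_right, div_eq_inv_mul]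
      exact mul_le_mul_of_nonneg_right (inv_anti₀ hδ hx) (abs_nonneg _))
  refine h1.trans ?_
  rw [inv_div, div_eq_inv_mul, inv_pow]
  exact mul_le_mul_of_nonneg_left hE (by positivity)

theorem effRes_le_ofReal {G : Finset (E × Sym2 V)} {w : E × Sym2 V → ℝ≥0} {u v : V} {θ : ℝ}
    (hθ : 0 < θ) (h : ∀ x : V → ℝ, x u = 1 → x v = 0 → θ⁻¹ ≤ energy G w x) :
    effRes G w u v ≤ ENNReal.ofReal θ := by
  rw [effRes, ENNReal.inv_le_iff_inv_le, ← ENNReal.ofReal_inv_of_pos hθ]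
  exact le_iInf₂ fun x hx => ENNReal.ofReal_le_ofReal (h x hx.1 hx.2)

end potentials

/-! ### Cliques and multigraphs -/

section energies

open NamedHypergraph

variable {V E : Type*} [DecidableEq V] [DecidableEq E]

theorem mk_mem_clique {s : Finset V} {a b : V} :
    s(a, b) ∈ clique s ↔ a ∈ s ∧ b ∈ s ∧ a ≠ b := by
  simp [clique, and_assoc]

theorem two_mul_sum_clique (s : Finset V) (F : Sym2 V → ℝ) :
    2 * ∑ p ∈ clique s, F p = ∑ x ∈ s.offDiag, F s(x.1, x.2) := by
  rw [← Finset.sum_fiberwise_of_maps_to (t := clique s) (g := fun x : V × V => s(x.1, x.2)),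
    Finset.mul_sum]
  · refine Finset.sum_congr rfl fun p hp => ?_
    induction p using Sym2.ind with
    | _ a b =>
      obtain ⟨ha, hb, hab⟩ := mk_mem_clique.1 hp
      have : (s.offDiag.filter fun x : V × V => s(x.1, x.2) = s(a, b)) = {(a, b), (b, a)} := by
        ext ⟨c, d⟩
        simp only [Finset.mem_filter, Finset.mem_offDiag, Sym2.eq_iff, Finset.mem_insert,
          Finset.mem_singleton, Prod.mk.injEq]
        constructor
        · exact fun h => h.2
        · rintro (⟨rfl, rfl⟩ | ⟨rfl, rfl⟩)
          · exact ⟨⟨ha, hb, hab⟩, Or.inl ⟨rfl, rfl⟩⟩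
          · exact ⟨⟨hb, ha, hab.symm⟩, Or.inr ⟨rfl, rfl⟩⟩
      rw [this, Finset.sum_pair (by simp [hab]), Sym2.eq_swap (a := b), two_mul]
  · rintro ⟨a, b⟩ h
    exact mk_mem_clique.2 (Finset.mem_offDiag.1 h)

theorem two_mul_sum_clique_of_diag (s : Finset V) (F : Sym2 V → ℝ) (hF : ∀ a, F s(a, a) = 0) :
    2 * ∑ p ∈ clique s, F p = ∑ a ∈ s, ∑ b ∈ s, F s(a, b) := by
  rw [two_mul_sum_clique, ← Finset.sum_product',
    ← Finset.sum_sdiff (s₁ := s.offDiag) (s₂ := s ×ˢ s)]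
  · rw [right_eq_add]
    refine Finset.sum_eq_zero ?_
    rintro ⟨a, b⟩ h
    simp only [Finset.mem_sdiff, Finset.mem_product, Finset.mem_offDiag, not_and, not_not] at h
    rw [h.2 h.1.1 h.1.2, hF]
  · rintro ⟨a, b⟩ h
    simp only [Finset.mem_product, Finset.mem_offDiag] at h ⊢
    exact ⟨h.1, h.2.1⟩

theorem sum_multigraph (H : NamedHypergraph V E) (F : E × Sym2 V → ℝ) :
    ∑ f ∈ H.multigraph, F f = ∑ e ∈ H.edges, ∑ p ∈ clique (H.verts e), F (e, p) := by
  rw [multigraph, Finset.sum_biUnion]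
  · refine Finset.sum_congr rfl fun e _ => ?_
    rw [Finset.sum_image]
    intro p _ q _ h
    simpa using h
  · intro e _ e' _ hee
    rw [Function.onFun, Finset.disjoint_left]
    intro f hf hf'
    simp only [Finset.mem_image] at hf hf'
    obtain ⟨p, _, rfl⟩ := hf
    obtain ⟨q, _, hq⟩ := hf'
    exact hee (congrArg Prod.fst hq).symm

theorem mem_multigraph {H : NamedHypergraph V E} {e : E} {p : Sym2 V} :
    (e, p) ∈ H.multigraph ↔ e ∈ H.edges ∧ p ∈ clique (H.verts e) := by
  simp only [multigraph, Finset.mem_biUnion, Finset.mem_image, Prod.mk.injEq]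
  constructor
  · rintro ⟨e', h, p', hp, rfl, rfl⟩
    exact ⟨h, hp⟩
  · exact fun h => ⟨e, h.1, p, h.2, rfl, rfl⟩

theorem energy_multigraph (H : NamedHypergraph V E) (w : E × Sym2 V → ℝ≥0) (x : V → ℝ) :
    energy H.multigraph w x =
      ∑ e ∈ H.edges, ∑ p ∈ clique (H.verts e), (w (e, p) : ℝ) * sqDiff x p :=
  sum_multigraph H fun f => (w f : ℝ) * sqDiff x f.2

/-! ### One round of vertex sampling -/

variable [Fintype V] [Fintype E]

/-- The probability, given that `V'` is the set of kept vertices, that at least one multi-edge of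
the hyperedge `e` gets sampled. -/
noncomputable def condCatch (lam : ℝ≥0∞) (X : NamedHypergraph V E) (V' : Finset V) (e : E) : ℝ :=
  1 - ∏ f ∈ Finset.univ.filter (fun f : E × Sym2 V => f.1 = e),
    (1 - (min 1 (if f ∈ (X.project V').multigraph then
      lam * pairRes (X.project V').multigraph (fun _ => 1) f.2 else 0)).toReal)

/-- The probability that the hyperedge `e` is found in one round of vertex sampling. -/
noncomputable def catchProb (r : ℕ) (lam : ℝ≥0∞) (X : NamedHypergraph V E) (e : E) : ℝ :=
  prob (vsRound r lam X) {F | e ∈ F}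

theorem catchProb_eq_sum (r : ℕ) (lam : ℝ≥0∞) (X : NamedHypergraph V E) (e : E) :
    catchProb r lam X e = ∑ V', vertexWeight r V' * condCatch lam X V' e := by
  rw [catchProb, vsRound, prob_bind]
  refine Finset.sum_congr rfl fun V' _ => ?_
  rw [prob_map, condCatch, ← prob_randomSubset_meets, vertexWeight]
  congr 2
  ext S
  simp [Finset.not_disjoint_iff]

theorem condCatch_nonneg (lam : ℝ≥0∞) (X : NamedHypergraph V E) (V' : Finset V) (e : E) :
    0 ≤ condCatch lam X V' e := by
  rw [condCatch, ← prob_randomSubset_meets]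
  exact prob_nonneg _ _

theorem catchProb_nonneg (r : ℕ) (lam : ℝ≥0∞) (X : NamedHypergraph V E) (e : E) :
    0 ≤ catchProb r lam X e := prob_nonneg _ _

theorem catchProb_le_one (r : ℕ) (lam : ℝ≥0∞) (X : NamedHypergraph V E) (e : E) :
    catchProb r lam X e ≤ 1 := prob_le_one _ _

theorem condCatch_eq_zero {lam : ℝ≥0∞} {X : NamedHypergraph V E} {V' : Finset V} {e : E}
    (he : e ∉ X.edges) : condCatch lam X V' e = 0 := by
  rw [condCatch, sub_eq_zero, eq_comm]
  refine Finset.prod_eq_one ?_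
  rintro ⟨e', p⟩ hf
  obtain rfl : e' = e := (Finset.mem_filter.1 hf).2
  have h : (e', p) ∉ (X.project V').multigraph := fun h => he (mem_multigraph.1 h).1
  simp [h]

theorem catchProb_eq_zero {r : ℕ} {lam : ℝ≥0∞} {X : NamedHypergraph V E} {e : E}
    (he : e ∉ X.edges) : catchProb r lam X e = 0 := by
  simp [catchProb_eq_sum, condCatch_eq_zero he]

/-- Deleting other hyperedges increases effective resistances, hence the probability that a
surviving hyperedge is found. -/
theorem condCatch_anti {lam : ℝ≥0∞} {vt : E → Finset V} {Y Z : Finset E} (h : Y ⊆ Z)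
    (V' : Finset V) {e : E} (he : e ∈ Y) :
    condCatch lam ⟨Z, vt⟩ V' e ≤ condCatch lam ⟨Y, vt⟩ V' e := by
  rw [condCatch, condCatch]
  refine sub_le_sub_left (Finset.prod_le_prod (fun f _ => ?_) fun f hf => ?_) _
  · exact sub_nonneg.2 (toReal_min_one_le _)
  · refine sub_le_sub_left (toReal_min_one_mono ?_) _
    obtain ⟨e', p⟩ := f
    obtain rfl : e' = e := (Finset.mem_filter.1 hf).2
    have hsub : (project ⟨Y, vt⟩ V').multigraph ⊆ (project ⟨Z, vt⟩ V').multigraph := by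
      rintro ⟨g, q⟩ hq
      rw [mem_multigraph] at hq ⊢
      exact ⟨h hq.1, hq.2⟩
    by_cases hp : p ∈ clique (vt e' ∩ V')
    · rw [if_pos (mem_multigraph.2 ⟨h he, hp⟩), if_pos (mem_multigraph.2 ⟨he, hp⟩)]
      exact mul_le_mul_right (pairRes_anti hsub _ _) _
    · rw [if_neg fun hq => hp (mem_multigraph.1 hq).2]
      exact zero_le

theorem catchProb_anti {r : ℕ} {lam : ℝ≥0∞} {vt : E → Finset V} {Y Z : Finset E} (h : Y ⊆ Z)
    {e : E} (he : e ∈ Y) : catchProb r lam ⟨Z, vt⟩ e ≤ catchProb r lam ⟨Y, vt⟩ e := by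
  rw [catchProb_eq_sum, catchProb_eq_sum]
  exact Finset.sum_le_sum fun V' _ =>
    mul_le_mul_of_nonneg_left (condCatch_anti h V' he) (vertexWeight_nonneg V')

/-- A potential of small energy on the projected multigraph that separates two vertices of `e`
makes it likely that `e` is found. -/
theorem le_condCatch {l : ℝ} (hl : 0 ≤ l) {X : NamedHypergraph V E} {V' : Finset V} {e : E}
    (he : e ∈ X.edges) {u v : V} (hu : u ∈ X.verts e ∩ V') (hv : v ∈ X.verts e ∩ V')
    (x : V → ℝ) {δ Φ : ℝ} (hδ : 0 < δ) (hΦ : 0 < Φ) (hx : δ ≤ |x u - x v|)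
    (hE : energy (X.project V').multigraph (fun _ => 1) x ≤ Φ) :
    min 1 (l * (δ ^ 2 / Φ)) ≤ condCatch (ENNReal.ofReal l) X V' e := by
  have huv : u ≠ v := by
    rintro rfl
    simp at hx
    linarith
  have hmem : (e, s(u, v)) ∈ (X.project V').multigraph :=
    mem_multigraph.2 ⟨he, mk_mem_clique.2 ⟨hu, hv, huv⟩⟩
  rw [condCatch, le_sub_comm]
  rw [← Finset.mul_prod_erase _ _ (a := (e, s(u, v))) (by simp)]
  refine (mul_le_of_le_one_right (sub_nonneg.2 (toReal_min_one_le _))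
    (Finset.prod_le_one (fun f _ => sub_nonneg.2 (toReal_min_one_le _))
      fun f _ => sub_le_self _ ENNReal.toReal_nonneg)).trans ?_
  refine sub_le_sub_left ?_ _
  rw [if_pos hmem]
  have h1 : ENNReal.ofReal (l * (δ ^ 2 / Φ)) ≤ ENNReal.ofReal l *
      pairRes (X.project V').multigraph (fun _ => 1) s(u, v) := by
    rw [ENNReal.ofReal_mul hl]
    exact mul_le_mul_right (le_effRes x hδ hΦ hx hE) _
  refine le_trans ?_ (toReal_min_one_mono h1)
  rw [← ENNReal.ofReal_one, ← ENNReal.ofReal_min, ENNReal.toReal_ofReal (by positivity)]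

end energies

/-! ### The deterministic schedule of deletions -/

section schedule

variable {V E : Type*} [Fintype V] [DecidableEq V] [Fintype E] [DecidableEq E]

/-- The total probability with which the hyperedge `e` is exposed to being found in the first `t`
rounds, when each round is run on the hyperedges whose exposure has been smaller than `L` so
far. -/
noncomputable def exposure (r : ℕ) (lam : ℝ≥0∞) (L : ℝ) (H : NamedHypergraph V E) :
    ℕ → E → ℝ
  | 0 => fun _ => 0
  | t + 1 => fun e => exposure r lam L H t e +
      catchProb r lam ⟨H.edges.filter fun e' => exposure r lam L H t e' < L, H.verts⟩ e

/-- The hyperedges whose exposure in the first `t` rounds is smaller than `L`: with high probability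
they contain everything that vertex sampling has not found after `t` rounds. -/
noncomputable def alive (r : ℕ) (lam : ℝ≥0∞) (L : ℝ) (H : NamedHypergraph V E) (t : ℕ) :
    Finset E :=
  H.edges.filter fun e => exposure r lam L H t e < L

variable {r : ℕ} {lam : ℝ≥0∞} {L : ℝ} {H : NamedHypergraph V E}

theorem exposure_succ (t : ℕ) (e : E) :
    exposure r lam L H (t + 1) e =
      exposure r lam L H t e + catchProb r lam ⟨alive r lam L H t, H.verts⟩ e := rfl

theorem alive_subset (t : ℕ) : alive r lam L H t ⊆ H.edges := Finset.filter_subset _ _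

theorem exposure_eq_sum (t : ℕ) (e : E) :
    exposure r lam L H t e =
      ∑ s ∈ Finset.range t, catchProb r lam ⟨alive r lam L H s, H.verts⟩ e := by
  induction t with
  | zero => rfl
  | succ t ih => rw [exposure_succ, Finset.sum_range_succ, ih]

theorem exposure_le (hL : 0 ≤ L) (t : ℕ) (e : E) : exposure r lam L H t e ≤ L + 1 := by
  induction t with
  | zero => exact add_nonneg hL zero_le_one
  | succ t ih =>
    rw [exposure_succ]
    by_cases he : e ∈ alive r lam L H t
    · have h1 := (Finset.mem_filter.1 he).2
      have h2 := catchProb_le_one r lam ⟨alive r lam L H t, H.verts⟩ e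
      linarith
    · rw [catchProb_eq_zero he, add_zero]
      exact ih

/-- The sum `∑ e ∈ Y, exp (exposure t e - L)` over the hyperedges `Y` that are present after `t`
rounds is a supermartingale as long as `Y` is contained in the schedule, and it is at least `1` once
`Y` is not.  It therefore bounds the probability that a hyperedge outlives its schedule. -/
theorem prob_missed_le (k : ℕ) : ∀ (t : ℕ) (Y : Finset E), Y ⊆ H.edges → ∀ e₀ ∈ Y,
    e₀ ∉ alive r lam L H (t + k) →
    prob (vertexSampling r lam k ⟨Y, H.verts⟩) {F | e₀ ∉ F} ≤
      ∑ e ∈ Y, Real.exp (exposure r lam L H t e - L) := by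
  have hbig : ∀ (t : ℕ) (Y : Finset E), Y ⊆ H.edges → ¬ Y ⊆ alive r lam L H t →
      1 ≤ ∑ e ∈ Y, Real.exp (exposure r lam L H t e - L) := by
    intro t Y hY hn
    obtain ⟨e, he, hne⟩ := Finset.not_subset.1 hn
    have h1 : L ≤ exposure r lam L H t e := by
      by_contra! h
      exact hne (Finset.mem_filter.2 ⟨hY he, h⟩)
    exact (Real.one_le_exp (sub_nonneg.2 h1)).trans
      (Finset.single_le_sum (f := fun e => Real.exp (exposure r lam L H t e - L))
        (fun _ _ => (Real.exp_pos _).le) he)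
  induction k with
  | zero =>
    intro t Y hY e₀ he₀ hn
    exact (prob_le_one _ _).trans (hbig t Y hY fun h => hn (h he₀))
  | succ k ih =>
    intro t Y hY e₀ he₀ hn
    by_cases hYt : Y ⊆ alive r lam L H t
    swap
    · exact (prob_le_one _ _).trans (hbig t Y hY hYt)
    have hstep : ∀ F' : Finset E,
        prob ((vertexSampling r lam k (NamedHypergraph.delete ⟨Y, H.verts⟩ F')).map
          fun F => F' ∪ F) {F | e₀ ∉ F} ≤
        ∑ e ∈ Y, (if e ∈ F' then 0 else 1) * Real.exp (exposure r lam L H (t + 1) e - L) := by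
      intro F'
      rw [prob_map]
      by_cases he : e₀ ∈ F'
      · have : (fun F => F' ∪ F) ⁻¹' {F : Finset E | e₀ ∉ F} = ∅ := by
          ext F
          simp [he]
        rw [this]
        simp only [prob, MeasureTheory.measure_empty, ENNReal.toReal_zero]
        positivity
      · have : (fun F => F' ∪ F) ⁻¹' {F : Finset E | e₀ ∉ F} = {F | e₀ ∉ F} := by
          ext F
          simp [he]
        rw [this]
        refine (ih (t + 1) (Y \ F') (Finset.sdiff_subset.trans hY) e₀ (by simp [he₀, he])
          (by rwa [add_assoc, add_comm 1 k])).trans_eq ?_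
        rw [← Finset.filter_notMem_eq_sdiff, Finset.sum_filter]
        refine Finset.sum_congr rfl fun e _ => ?_
        by_cases h : e ∈ F' <;> simp [h]
    rw [vertexSampling, prob_bind]
    calc _ ≤ ∑ F', (vsRound r lam ⟨Y, H.verts⟩ F').toReal *
          ∑ e ∈ Y, (if e ∈ F' then 0 else 1) * Real.exp (exposure r lam L H (t + 1) e - L) :=
          Finset.sum_le_sum fun F' _ =>
            mul_le_mul_of_nonneg_left (hstep F') ENNReal.toReal_nonneg
      _ = ∑ e ∈ Y, (1 - catchProb r lam ⟨Y, H.verts⟩ e) *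
            Real.exp (exposure r lam L H (t + 1) e - L) := by
          simp_rw [Finset.mul_sum]
          rw [Finset.sum_comm]
          refine Finset.sum_congr rfl fun e _ => ?_
          rw [catchProb, ← prob_compl, prob_fintype, Finset.sum_mul]
          refine Finset.sum_congr rfl fun F' _ => ?_
          by_cases h : e ∈ F' <;> simp [h]
      _ ≤ ∑ e ∈ Y, Real.exp (exposure r lam L H t e - L) := by
          refine Finset.sum_le_sum fun e he => ?_
          have h1 := catchProb_anti (r := r) (lam := lam) (vt := H.verts) hYt he
          have h2 := Real.add_one_le_exp (-catchProb r lam ⟨alive r lam L H t, H.verts⟩ e)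
          have h3 : Real.exp (exposure r lam L H t e - L) =
              Real.exp (-catchProb r lam ⟨alive r lam L H t, H.verts⟩ e) *
                Real.exp (exposure r lam L H (t + 1) e - L) := by
            rw [← Real.exp_add, exposure_succ]
            congr 1
            ring
          rw [h3]
          exact mul_le_mul_of_nonneg_right (by linarith) (Real.exp_pos _).le

/-- A hyperedge that the schedule deletes within `k` rounds is found by `k` rounds of vertex
sampling, up to a probability of `exp (-L)` for every hyperedge. -/
theorem le_prob_found {k : ℕ} {e : E} (he : e ∈ H.edges) (hk : e ∉ alive r lam L H k) :
    1 - H.edges.card * Real.exp (-L) ≤ prob (vertexSampling r lam k H) {F | e ∈ F} := by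
  have h := prob_missed_le k 0 H.edges subset_rfl e he (by rwa [zero_add])
  have hc : {F : Finset E | e ∉ F} = {F | e ∈ F}ᶜ := rfl
  rw [hc, prob_compl] at h
  simp only [exposure, zero_sub, Finset.sum_const, nsmul_eq_mul] at h
  linarith

end schedule

/-! ### The expected energy of a potential on the projected hypergraph -/

section core

open NamedHypergraph

variable {V E : Type*}

/-- The energy of `z` when every pair inside a hyperedge of `Y` has conductance `1 / r ^ 2`, the
probability that both ends are kept. -/
noncomputable def spreadEnergy (r : ℕ) (vt : E → Finset V) (Y : Finset E) (z : V → ℝ) : ℝ :=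
  ∑ g ∈ Y, (r : ℝ)⁻¹ ^ 2 / 2 * ∑ a ∈ vt g, ∑ b ∈ vt g, (z a - z b) ^ 2

theorem spreadEnergy_nonneg (r : ℕ) (vt : E → Finset V) (Y : Finset E) (z : V → ℝ) :
    0 ≤ spreadEnergy r vt Y z := by
  unfold spreadEnergy
  positivity

variable [DecidableEq V] [DecidableEq E]

/-- The energy of `z` when every pair that joins `u` to another vertex of a hyperedge of `Y` has
conductance `1 / r`, the probability that its other end is kept. -/
noncomputable def starEnergy (r : ℕ) (vt : E → Finset V) (Y : Finset E) (u : V) (z : V → ℝ) : ℝ :=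
  ∑ g ∈ Y with u ∈ vt g, (r : ℝ)⁻¹ * ∑ b ∈ vt g, (z u - z b) ^ 2

theorem two_mul_energy_project (vt : E → Finset V) (Y : Finset E) (V' : Finset V) (z : V → ℝ) :
    2 * energy (project ⟨Y, vt⟩ V').multigraph (fun _ => 1) z =
      ∑ g ∈ Y, ∑ a ∈ vt g, ∑ b ∈ vt g, (if a ∈ V' ∧ b ∈ V' then 1 else 0) * (z a - z b) ^ 2 := by
  rw [energy_multigraph, Finset.mul_sum]
  refine Finset.sum_congr rfl fun g _ => ?_
  simp only [NNReal.coe_one, one_mul]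
  rw [two_mul_sum_clique_of_diag _ _ (fun a => by simp)]
  simp only [project, ← Finset.filter_mem_eq_inter, Finset.sum_filter]
  refine Finset.sum_congr rfl fun a _ => ?_
  by_cases ha : a ∈ V' <;> simp [ha]

variable [Fintype V]

theorem sum_vertexWeight_energy_le {r : ℕ} (hr : 1 ≤ r) (vt : E → Finset V) (Y : Finset E) (u : V)
    (z : V → ℝ) :
    ∑ V', vertexWeight r V' * ((if u ∈ V' then 1 else 0) *
      energy (project ⟨Y, vt⟩ V').multigraph (fun _ => 1) z) ≤
      (r : ℝ)⁻¹ * (spreadEnergy r vt Y z + starEnergy r vt Y u z) := by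
  set ρ : ℝ := (r : ℝ)⁻¹ with hρ
  have hρ0 : 0 ≤ ρ := by positivity
  -- The probability that `u`, `a` and `b` are kept depends on whether `u` is one of `a` and `b`.
  have key : ∀ a b : V, (∑ V', vertexWeight r V' * (if {u, a, b} ⊆ V' then 1 else 0)) *
      (z a - z b) ^ 2 ≤ ρ ^ 3 * (z a - z b) ^ 2 + (if u = a then ρ ^ 2 * (z u - z b) ^ 2 else 0) +
        (if u = b then ρ ^ 2 * (z u - z a) ^ 2 else 0) := by
    intro a b
    rw [vertexWeight_sum_subset hr, ← hρ]
    by_cases hab : a = b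
    · subst hab
      simp only [sub_self, ne_eq, OfNat.ofNat_ne_zero, not_false_eq_true, zero_pow, mul_zero]
      positivity
    · by_cases hua : u = a
      · subst hua
        rw [Finset.insert_eq_of_mem (by simp), Finset.card_pair hab]
        simp only [if_true, if_neg hab]
        nlinarith [mul_nonneg (pow_nonneg hρ0 3) (sq_nonneg (z u - z b))]
      · by_cases hub : u = b
        · subst hub
          rw [Finset.insert_eq_of_mem (by simp), Finset.card_pair hab]
          simp only [if_true, if_neg hua]
          nlinarith [mul_nonneg (pow_nonneg hρ0 3) (sq_nonneg (z u - z a))]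
        · rw [Finset.card_insert_of_notMem (by simp [hua, hub]), Finset.card_pair hab]
          simp [hua, hub]
  have e1 : 2 * ∑ V', vertexWeight r V' * ((if u ∈ V' then 1 else 0) *
      energy (project ⟨Y, vt⟩ V').multigraph (fun _ => 1) z) =
      ∑ g ∈ Y, ∑ a ∈ vt g, ∑ b ∈ vt g,
        (∑ V', vertexWeight r V' * (if {u, a, b} ⊆ V' then 1 else 0)) * (z a - z b) ^ 2 := by
    simp_rw [Finset.sum_mul]
    rw [Finset.mul_sum]
    simp_rw [mul_left_comm (2 : ℝ), two_mul_energy_project, Finset.mul_sum]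
    rw [Finset.sum_comm]
    refine Finset.sum_congr rfl fun g _ => ?_
    rw [Finset.sum_comm]
    refine Finset.sum_congr rfl fun a _ => ?_
    rw [Finset.sum_comm]
    refine Finset.sum_congr rfl fun b _ => Finset.sum_congr rfl fun V' _ => ?_
    simp only [Finset.insert_subset_iff, Finset.singleton_subset_iff]
    by_cases hu : u ∈ V' <;> simp [hu]
  have e2 : 2 * (ρ * (spreadEnergy r vt Y z + starEnergy r vt Y u z)) =
      ∑ g ∈ Y, ∑ a ∈ vt g, ∑ b ∈ vt g, (ρ ^ 3 * (z a - z b) ^ 2 +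
        (if u = a then ρ ^ 2 * (z u - z b) ^ 2 else 0) +
        (if u = b then ρ ^ 2 * (z u - z a) ^ 2 else 0)) := by
    rw [spreadEnergy, starEnergy, Finset.sum_filter, ← Finset.sum_add_distrib, Finset.mul_sum,
      Finset.mul_sum]
    refine Finset.sum_congr rfl fun g _ => ?_
    simp only [Finset.sum_add_distrib]
    rw [Finset.sum_comm (f := fun a b => if u = a then ρ ^ 2 * (z u - z b) ^ 2 else 0)]
    simp only [Finset.sum_ite_eq]
    simp only [← Finset.mul_sum, ← hρ]
    split_ifs with hu
    · simp only [← Finset.mul_sum]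
      ring
    · simp only [Finset.sum_const_zero]
      ring
  have := Finset.sum_le_sum fun g (_ : g ∈ Y) => Finset.sum_le_sum fun a (_ : a ∈ vt g) =>
    Finset.sum_le_sum fun b (_ : b ∈ vt g) => key a b
  rw [← e1, ← e2] at this
  linarith

end core

/-! ### Catching a hyperedge at a kept vertex -/

section separation

open NamedHypergraph

variable {V E : Type*} [Fintype V] [DecidableEq V] [Fintype E] [DecidableEq E]

/-- The probability that in one round the vertex `u` is kept, at most `30` vertices of the
hyperedge `g` are kept, and `g` is found.  The cap makes the sum over the vertices `u` of `g`
comparable with the probability that `g` is found. -/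
noncomputable def starCatch (r : ℕ) (lam : ℝ≥0∞) (X : NamedHypergraph V E) (g : E) (u : V) : ℝ :=
  ∑ V', vertexWeight r V' *
    (if u ∈ V' ∧ (X.verts g ∩ V').card ≤ 30 then condCatch lam X V' g else 0)

theorem starCatch_nonneg (r : ℕ) (lam : ℝ≥0∞) (X : NamedHypergraph V E) (g : E) (u : V) :
    0 ≤ starCatch r lam X g u :=
  Finset.sum_nonneg fun V' _ => mul_nonneg (vertexWeight_nonneg V')
    (by split_ifs <;> first | exact condCatch_nonneg _ _ _ _ | exact le_rfl)

theorem starCatch_le_catchProb (r : ℕ) (lam : ℝ≥0∞) (X : NamedHypergraph V E) (g : E) (u : V) :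
    starCatch r lam X g u ≤ catchProb r lam X g := by
  rw [catchProb_eq_sum]
  refine Finset.sum_le_sum fun V' _ => mul_le_mul_of_nonneg_left ?_ (vertexWeight_nonneg V')
  split_ifs
  · exact le_rfl
  · exact condCatch_nonneg _ _ _ _

theorem sum_starCatch_le (r : ℕ) (lam : ℝ≥0∞) (X : NamedHypergraph V E) (g : E) :
    ∑ u ∈ X.verts g, starCatch r lam X g u ≤ 30 * catchProb r lam X g := by
  simp only [starCatch]
  rw [Finset.sum_comm, catchProb_eq_sum, Finset.mul_sum]
  refine Finset.sum_le_sum fun V' _ => ?_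
  rw [← Finset.mul_sum, mul_left_comm]
  refine mul_le_mul_of_nonneg_left ?_ (vertexWeight_nonneg V')
  by_cases hc : (X.verts g ∩ V').card ≤ 30
  · simp only [hc, and_true]
    rw [← Finset.sum_filter, Finset.filter_mem_eq_inter, Finset.sum_const, nsmul_eq_mul]
    exact mul_le_mul_of_nonneg_right (by exact_mod_cast hc) (condCatch_nonneg _ _ _ _)
  · simp only [hc, and_false, if_false, Finset.sum_const_zero]
    exact mul_nonneg (by norm_num) (condCatch_nonneg _ _ _ _)

/-- If a potential separates `u` by `δ` from half of the vertices of a hyperedge `g ∋ u`, its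
expected energy on the projected multigraph, given that `u` is kept, bounds from below the
probability that `g` is found while `u` is kept: with constant probability one of those vertices is
kept, the energy is at most ten times its expectation, and only a bounded number of vertices of `g`
is kept. -/
theorem le_starCatch {r : ℕ} (hr : 1 ≤ r) {vt : E → Finset V} {Y : Finset E} {g : E} (hg : g ∈ Y)
    (hg2 : (vt g).card ≤ 2 * r) {u : V} (hu : u ∈ vt g) {S : Finset V} (hS : S ⊆ vt g)
    (hSr : r ≤ 2 * S.card) {l : ℝ} (hl : 0 ≤ l) (z : V → ℝ) {δ Φ : ℝ} (hδ : 0 < δ) (hΦ : 0 < Φ)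
    (hz : ∀ b ∈ S, δ ≤ |z u - z b|)
    (hE : spreadEnergy r vt Y z + starEnergy r vt Y u z ≤ Φ) :
    1 / (8 * r) * min 1 (l * (δ ^ 2 / (10 * Φ))) ≤
      starCatch r (ENNReal.ofReal l) ⟨Y, vt⟩ g u := by
  set ρ : ℝ := (r : ℝ)⁻¹ with hρ
  have hr0 : (0 : ℝ) < r := by exact_mod_cast hr
  have hρ0 : 0 < ρ := by positivity
  have hρ1 : ρ ≤ 1 := inv_le_one_of_one_le₀ (by exact_mod_cast hr)
  set k : ℝ := min 1 (l * (δ ^ 2 / (10 * Φ))) with hk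
  have hk0 : 0 ≤ k := by positivity
  have huS : u ∉ S := by
    intro h
    have := hz u h
    simp at this
    linarith
  let en : Finset V → ℝ := fun V' => energy (project ⟨Y, vt⟩ V').multigraph (fun _ => 1) z
  -- Outside the three exceptional events the conditional probability is at least `k`; on each of
  -- them the left-hand side is nonpositive.
  have hpt : ∀ V' : Finset V,
      k * ((if u ∈ V' then 1 else 0) - (if {u} ⊆ V' ∧ Disjoint V' S then 1 else 0) -
        (∑ a ∈ vt g, if {u, a} ⊆ V' then 1 else 0) / 30 -
        (if u ∈ V' then 1 else 0) * en V' / (10 * Φ)) ≤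
      if u ∈ V' ∧ (vt g ∩ V').card ≤ 30 then
        condCatch (ENNReal.ofReal l) ⟨Y, vt⟩ V' g else 0 := by
    intro V'
    have hen : 0 ≤ en V' := energy_nonneg _ _ _
    by_cases huV : u ∈ V'
    · have hcard : (∑ a ∈ vt g, if {u, a} ⊆ V' then (1 : ℝ) else 0) = (vt g ∩ V').card := by
        simp only [Finset.insert_subset_iff, huV, true_and, Finset.singleton_subset_iff]
        rw [← Finset.sum_filter, Finset.filter_mem_eq_inter]
        simp
      rw [hcard]
      simp only [huV, true_and, if_true, Finset.singleton_subset_iff, one_mul]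
      have hen' : 0 ≤ en V' / (10 * Φ) := by positivity
      by_cases hd : Disjoint V' S
      · rw [if_pos hd]
        refine le_trans (mul_nonpos_of_nonneg_of_nonpos hk0 ?_) ?_
        · have : (0 : ℝ) ≤ (vt g ∩ V').card / 30 := by positivity
          linarith
        · split_ifs
          · exact condCatch_nonneg _ _ _ _
          · exact le_rfl
      · rw [if_neg hd]
        by_cases hc : (vt g ∩ V').card ≤ 30
        · rw [if_pos hc]
          by_cases hen2 : en V' ≤ 10 * Φ
          · obtain ⟨b, hbV, hbS⟩ := Finset.not_disjoint_iff.1 hd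
            have h1 := le_condCatch hl (X := ⟨Y, vt⟩) hg (Finset.mem_inter.2 ⟨hu, huV⟩)
              (Finset.mem_inter.2 ⟨hS hbS, hbV⟩) z hδ (by positivity : 0 < 10 * Φ) (hz b hbS) hen2
            refine le_trans (mul_le_of_le_one_right hk0 ?_) h1
            have : (0 : ℝ) ≤ (vt g ∩ V').card / 30 := by positivity
            linarith
          · refine le_trans (mul_nonpos_of_nonneg_of_nonpos hk0 ?_) (condCatch_nonneg _ _ _ _)
            have h1 : 1 ≤ en V' / (10 * Φ) := by
              rw [one_le_div (by positivity)]
              exact (not_le.1 hen2).le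
            have : (0 : ℝ) ≤ (vt g ∩ V').card / 30 := by positivity
            linarith
        · rw [if_neg hc]
          refine mul_nonpos_of_nonneg_of_nonpos hk0 ?_
          have h1 : (1 : ℝ) ≤ (vt g ∩ V').card / 30 := by
            rw [one_le_div (by norm_num)]
            exact_mod_cast (not_le.1 hc).le
          linarith
    · have h0 : ∀ a, ¬ ({u, a} ⊆ V') := fun a h => huV (h (by simp))
      simp [huV, h0]
  have hsum : k * ((∑ V', vertexWeight r V' * (if u ∈ V' then 1 else 0)) -
      (∑ V', vertexWeight r V' * (if {u} ⊆ V' ∧ Disjoint V' S then 1 else 0)) -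
      (∑ a ∈ vt g, ∑ V', vertexWeight r V' * (if {u, a} ⊆ V' then 1 else 0)) / 30 -
      (∑ V', vertexWeight r V' * ((if u ∈ V' then 1 else 0) * en V')) / (10 * Φ)) ≤
      starCatch r (ENNReal.ofReal l) ⟨Y, vt⟩ g u := by
    refine le_trans (le_of_eq ?_) (Finset.sum_le_sum fun V' _ =>
      mul_le_mul_of_nonneg_left (hpt V') (vertexWeight_nonneg V'))
    rw [Finset.sum_comm, Finset.sum_div, Finset.sum_div, ← Finset.sum_sub_distrib,
      ← Finset.sum_sub_distrib, ← Finset.sum_sub_distrib, Finset.mul_sum]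
    refine Finset.sum_congr rfl fun V' _ => ?_
    rw [← Finset.mul_sum]
    ring
  have h1 : ∑ V', vertexWeight r V' * (if u ∈ V' then 1 else 0) = ρ := by
    have := vertexWeight_sum_subset hr ({u} : Finset V)
    simpa using this
  have h2 : ∑ V', vertexWeight r V' * (if {u} ⊆ V' ∧ Disjoint V' S then 1 else 0) ≤
      ρ * (2 / 3) := by
    rw [vertexWeight_sum hr (Finset.disjoint_singleton_left.2 huS), Finset.card_singleton, pow_one]
    refine mul_le_mul_of_nonneg_left ?_ hρ0.le
    calc (1 - (r : ℝ)⁻¹) ^ S.card ≤ Real.exp (-ρ) ^ S.card :=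
          pow_le_pow_left₀ (sub_nonneg.2 hρ1) (Real.one_sub_le_exp_neg ρ) _
      _ = Real.exp (-(S.card * ρ)) := by rw [← Real.exp_nat_mul, mul_neg]
      _ ≤ Real.exp (-(1 / 2)) := by
          refine Real.exp_le_exp.2 (neg_le_neg ?_)
          rw [hρ, ← div_eq_mul_inv, le_div_iff₀ hr0]
          have : (r : ℝ) ≤ 2 * S.card := by exact_mod_cast hSr
          linarith
      _ ≤ 2 / 3 := by
          rw [Real.exp_neg]
          have := Real.add_one_le_exp (1 / 2 : ℝ)
          rw [inv_le_comm₀ (Real.exp_pos _) (by norm_num)]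
          linarith
  have h3 : ∑ a ∈ vt g, ∑ V', vertexWeight r V' * (if {u, a} ⊆ V' then 1 else 0) ≤ 3 * ρ := by
    have h4 : ∀ a ∈ vt g, ∑ V', vertexWeight r V' * (if {u, a} ⊆ V' then 1 else 0) ≤
        (if u = a then ρ else 0) + ρ ^ 2 := by
      intro a _
      rw [vertexWeight_sum_subset hr, ← hρ]
      by_cases h : u = a
      · subst h
        simp only [Finset.pair_eq_singleton, Finset.card_singleton, pow_one, if_true]
        nlinarith
      · rw [Finset.card_pair h]
        simp [h]
    refine (Finset.sum_le_sum h4).trans ?_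
    rw [Finset.sum_add_distrib, Finset.sum_ite_eq, if_pos hu, Finset.sum_const, nsmul_eq_mul]
    have h5 : ((vt g).card : ℝ) * ρ ≤ 2 := by
      rw [hρ, ← div_eq_mul_inv, div_le_iff₀ hr0]
      exact_mod_cast hg2
    nlinarith
  have h4 : (∑ V', vertexWeight r V' * ((if u ∈ V' then 1 else 0) * en V')) / (10 * Φ) ≤
      ρ / 10 := by
    rw [div_le_div_iff₀ (by positivity) (by norm_num)]
    have h5 := sum_vertexWeight_energy_le hr vt Y u z
    have h6 : ρ * (spreadEnergy r vt Y z + starEnergy r vt Y u z) ≤ ρ * Φ :=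
      mul_le_mul_of_nonneg_left hE hρ0.le
    linarith
  refine le_trans ?_ hsum
  have h8 : 1 / (8 * (r : ℝ)) = ρ / 8 := by
    rw [hρ]
    field_simp
  rw [h8, mul_comm]
  refine mul_le_mul_of_nonneg_left ?_ hk0
  rw [h1]
  linarith

end separation

/-! ### Truncated potentials -/

section truncation

variable {V E : Type*}

theorem spreadEnergy_max_le (r : ℕ) (vt : E → Finset V) (Y : Finset E) (σ : V → ℝ) (s : ℝ) :
    spreadEnergy r vt Y (fun a => max (σ a) s) ≤ spreadEnergy r vt Y σ := by
  refine Finset.sum_le_sum fun g _ => mul_le_mul_of_nonneg_left ?_ (by positivity)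
  refine Finset.sum_le_sum fun a _ => Finset.sum_le_sum fun b _ => ?_
  exact sq_le_sq.2 (abs_max_sub_max_le_abs _ _ _)

/-- A sequence of `J` steps between bounded values drops by at most a factor of `2` somewhere. -/
theorem exists_le_two_mul_succ {f : ℕ → ℝ} {J : ℕ} (h : f 0 < 2 ^ J * f J) :
    ∃ k < J, f k ≤ 2 * f (k + 1) := by
  by_contra! hn
  have : ∀ k ≤ J, 2 ^ k * f k ≤ f 0 := by
    intro k
    induction k with
    | zero => simp
    | succ k ih =>
      intro hk
      have h1 := hn k hk
      have h2 := ih (by omega)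
      have h3 : (0 : ℝ) < 2 ^ k := by positivity
      rw [pow_succ]
      nlinarith
  exact absurd (this J le_rfl) (not_le.2 h)

/-- In a hyperedge where fewer than half of the vertices lie above the level `t`, the truncation at
`s > t` is paid for by the pairs with one end below `t` and the other above `s`. -/
theorem truncated_star_le_spread {r : ℕ} (hr : 1 ≤ r) {A : Finset V} (hA : r ≤ A.card)
    {σ : V → ℝ} (h1 : ∀ a, σ a ≤ 1) {s t d : ℝ} (hs : 0 ≤ s) (hd : 0 < d) (hst : t + d = s)
    (hbad : 2 * (A.filter fun b => t ≤ σ b).card < A.card) :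
    (r : ℝ)⁻¹ * ∑ b ∈ A, (max (σ b) s - s) ^ 2 ≤
      4 / d ^ 2 * ((r : ℝ)⁻¹ ^ 2 / 2 * ∑ a ∈ A, ∑ b ∈ A, (σ a - σ b) ^ 2) := by
  have hr0 : (0 : ℝ) < r := by exact_mod_cast hr
  set hi := A.filter fun b => s < σ b with hhi
  set lo := A.filter fun b => ¬ t ≤ σ b with hlo
  have hup : ∑ b ∈ A, (max (σ b) s - s) ^ 2 ≤ hi.card := by
    calc ∑ b ∈ A, (max (σ b) s - s) ^ 2 ≤ ∑ b ∈ A, (if s < σ b then 1 else 0) := by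
          refine Finset.sum_le_sum fun b _ => ?_
          split_ifs with h
          · rw [max_eq_left h.le]
            exact pow_le_one₀ (by linarith) (by linarith [h1 b])
          · rw [max_eq_right (not_lt.1 h)]
            simp
      _ = hi.card := by simp [hhi]
  have hlocard : (r : ℝ) ≤ 2 * lo.card := by
    have h3 := Finset.card_filter_add_card_filter_not (s := A) (fun b => t ≤ σ b)
    rw [← hlo] at h3
    have h2 : r ≤ 2 * lo.card := by omega
    exact_mod_cast h2
  have hdown : lo.card * (hi.card * d ^ 2) ≤ ∑ a ∈ A, ∑ b ∈ A, (σ a - σ b) ^ 2 := by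
    calc (lo.card : ℝ) * (hi.card * d ^ 2) = ∑ a ∈ lo, ∑ b ∈ hi, d ^ 2 := by simp
      _ ≤ ∑ a ∈ lo, ∑ b ∈ hi, (σ a - σ b) ^ 2 := by
          refine Finset.sum_le_sum fun a ha => Finset.sum_le_sum fun b hb => ?_
          have ha' := not_le.1 (Finset.mem_filter.1 ha).2
          have hb' := (Finset.mem_filter.1 hb).2
          rw [← neg_sub, neg_sq]
          exact pow_le_pow_left₀ hd.le (by linarith) 2
      _ ≤ ∑ a ∈ lo, ∑ b ∈ A, (σ a - σ b) ^ 2 :=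
          Finset.sum_le_sum fun a _ => Finset.sum_le_sum_of_subset_of_nonneg
            (Finset.filter_subset _ _) fun b _ _ => sq_nonneg _
      _ ≤ _ := Finset.sum_le_sum_of_subset_of_nonneg (Finset.filter_subset _ _)
          fun a _ _ => Finset.sum_nonneg fun b _ => sq_nonneg _
  set T := ∑ a ∈ A, ∑ b ∈ A, (σ a - σ b) ^ 2
  have h3 : (r : ℝ) * (hi.card * d ^ 2) ≤ 2 * T := by
    have : (r : ℝ) * (hi.card * d ^ 2) ≤ 2 * lo.card * (hi.card * d ^ 2) :=
      mul_le_mul_of_nonneg_right hlocard (by positivity)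
    linarith
  calc (r : ℝ)⁻¹ * ∑ b ∈ A, (max (σ b) s - s) ^ 2 ≤ (r : ℝ)⁻¹ * hi.card :=
        mul_le_mul_of_nonneg_left hup (by positivity)
    _ = (r : ℝ)⁻¹ ^ 2 / d ^ 2 * (r * (hi.card * d ^ 2)) := by field_simp
    _ ≤ (r : ℝ)⁻¹ ^ 2 / d ^ 2 * (2 * T) := mul_le_mul_of_nonneg_left h3 (by positivity)
    _ = _ := by ring

theorem inv_mul_sum_max_sq_le {r : ℕ} (hr : 1 ≤ r) {A : Finset V} (hA : A.card ≤ 2 * r)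
    {σ : V → ℝ} (h1 : ∀ a, σ a ≤ 1) {s : ℝ} (hs1 : s ≤ 1) (hs : 0 ≤ s) :
    (r : ℝ)⁻¹ * ∑ b ∈ A, (max (σ b) s - s) ^ 2 ≤ 2 := by
  have hr0 : (0 : ℝ) < r := by exact_mod_cast hr
  rw [inv_mul_le_iff₀ hr0]
  calc ∑ b ∈ A, (max (σ b) s - s) ^ 2 ≤ ∑ b ∈ A, (1 : ℝ) :=
        Finset.sum_le_sum fun b _ => pow_le_one₀ (sub_nonneg.2 (le_max_right _ _))
          (by linarith [max_le (h1 b) hs1])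
    _ = A.card := by simp
    _ ≤ r * 2 := by
        rw [mul_comm]
        exact_mod_cast hA

theorem le_inv_mul_sum_sq {r : ℕ} (hr : 1 ≤ r) {A : Finset V} {σ : V → ℝ} {u : V} (hσu : σ u = 0)
    {t : ℝ} (ht : 1 / 4 ≤ t) (hA : r ≤ 2 * (A.filter fun b => t ≤ σ b).card) :
    1 / 32 ≤ (r : ℝ)⁻¹ * ∑ b ∈ A, (σ u - σ b) ^ 2 := by
  have hr0 : (0 : ℝ) < r := by exact_mod_cast hr
  set S := A.filter fun b => t ≤ σ b
  have h2 : (r : ℝ) ≤ 2 * S.card := by exact_mod_cast hA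
  have h3 : (S.card : ℝ) * (1 / 16) ≤ ∑ b ∈ A, (σ u - σ b) ^ 2 := by
    calc (S.card : ℝ) * (1 / 16) = ∑ b ∈ S, (1 / 16 : ℝ) := by simp
      _ ≤ ∑ b ∈ S, (σ u - σ b) ^ 2 := by
          refine Finset.sum_le_sum fun b hb => ?_
          have hb' := (Finset.mem_filter.1 hb).2
          rw [hσu]
          nlinarith
      _ ≤ _ := Finset.sum_le_sum_of_subset_of_nonneg (Finset.filter_subset _ _)
          fun b _ _ => sq_nonneg _
  rw [inv_mul_eq_div, le_div_iff₀ hr0]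
  linarith

variable [DecidableEq V]

/-- The star energy of the potential `σ`, vanishing at `u`, after truncation from below at `s`. -/
theorem starEnergy_max {r : ℕ} {vt : E → Finset V} {Y : Finset E} {u : V} {σ : V → ℝ}
    (hσu : σ u = 0) {s : ℝ} (hs : 0 ≤ s) :
    starEnergy r vt Y u (fun a => max (σ a) s) =
      ∑ g ∈ Y with u ∈ vt g, (r : ℝ)⁻¹ * ∑ b ∈ vt g, (max (σ b) s - s) ^ 2 := by
  rw [starEnergy]
  simp only [hσu, max_eq_right hs]
  refine Finset.sum_congr rfl fun g _ => ?_
  congr 1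
  exact Finset.sum_congr rfl fun b _ => by ring

theorem starEnergy_max_anti {r : ℕ} {vt : E → Finset V} {Y : Finset E} {u : V} {σ : V → ℝ}
    (hσu : σ u = 0) {s t : ℝ} (hs : 0 ≤ s) (hst : s ≤ t) :
    starEnergy r vt Y u (fun a => max (σ a) t) ≤ starEnergy r vt Y u (fun a => max (σ a) s) := by
  rw [starEnergy_max hσu hs, starEnergy_max hσu (hs.trans hst)]
  refine Finset.sum_le_sum fun g _ => mul_le_mul_of_nonneg_left ?_ (by positivity)
  refine Finset.sum_le_sum fun b _ => ?_
  refine pow_le_pow_left₀ (sub_nonneg.2 (le_max_right _ _)) ?_ 2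
  rcases le_total (σ b) t with h | h
  · rw [max_eq_right h, sub_self]
    exact sub_nonneg.2 (le_max_right _ _)
  · rw [max_eq_left h, max_eq_left (hst.trans h)]
    linarith

theorem starEnergy_max_le {r : ℕ} (hr : 1 ≤ r) {vt : E → Finset V} {Y : Finset E}
    (hY : ∀ g ∈ Y, (vt g).card ≤ 2 * r) {u : V} {σ : V → ℝ} (h1 : ∀ a, σ a ≤ 1)
    (hσu : σ u = 0) {s : ℝ} (hs : 0 ≤ s) (hs1 : s ≤ 1) :
    starEnergy r vt Y u (fun a => max (σ a) s) ≤ 2 * Y.card := by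
  rw [starEnergy_max hσu hs]
  calc _ ≤ ∑ g ∈ Y with u ∈ vt g, (2 : ℝ) :=
        Finset.sum_le_sum fun g hg =>
          inv_mul_sum_max_sq_le hr (hY g (Finset.mem_filter.1 hg).1) h1 hs1 hs
    _ = 2 * (Y.filter fun g => u ∈ vt g).card := by simp [mul_comm]
    _ ≤ 2 * Y.card := by
        have := Finset.card_filter_le Y fun g => u ∈ vt g
        gcongr

/-- Up to the spread energy, the star energy beyond a level is bounded by the number of hyperedges
at `u` in which half of the vertices lie beyond a slightly lower level. -/
theorem starEnergy_max_le_card {r : ℕ} (hr : 1 ≤ r) {vt : E → Finset V} {Y : Finset E}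
    (hY : ∀ g ∈ Y, r ≤ (vt g).card ∧ (vt g).card ≤ 2 * r) {u : V} {σ : V → ℝ}
    (h1 : ∀ a, σ a ≤ 1) (hσu : σ u = 0) {s t d : ℝ} (hs : 0 ≤ s) (hs1 : s ≤ 1) (hd : 0 < d)
    (hst : t + d = s) :
    starEnergy r vt Y u (fun a => max (σ a) s) ≤
      2 * ((Y.filter fun g => u ∈ vt g).filter fun g =>
        (vt g).card ≤ 2 * ((vt g).filter fun b => t ≤ σ b).card).card +
      4 / d ^ 2 * spreadEnergy r vt Y σ := by
  have hr0 : (0 : ℝ) < r := by exact_mod_cast hr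
  rw [starEnergy_max hσu hs]
  have hterm : ∀ g ∈ Y.filter (fun g => u ∈ vt g),
      (r : ℝ)⁻¹ * ∑ b ∈ vt g, (max (σ b) s - s) ^ 2 ≤
      (if (vt g).card ≤ 2 * ((vt g).filter fun b => t ≤ σ b).card then 2 else 0) +
        4 / d ^ 2 * ((r : ℝ)⁻¹ ^ 2 / 2 * ∑ a ∈ vt g, ∑ b ∈ vt g, (σ a - σ b) ^ 2) := by
    intro g hg
    have hgY := hY g (Finset.mem_filter.1 hg).1
    split_ifs with hgood
    · refine le_add_of_le_of_nonneg ?_ (by positivity)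
      exact inv_mul_sum_max_sq_le hr hgY.2 h1 hs1 hs
    · rw [zero_add]
      exact truncated_star_le_spread hr hgY.1 h1 hs hd hst (not_le.1 hgood)
  refine (Finset.sum_le_sum hterm).trans ?_
  rw [Finset.sum_add_distrib]
  refine add_le_add ?_ ?_
  · rw [← Finset.sum_filter, Finset.sum_const, nsmul_eq_mul, mul_comm]
  · rw [← Finset.mul_sum, spreadEnergy]
    exact mul_le_mul_of_nonneg_left (Finset.sum_le_sum_of_subset_of_nonneg
      (Finset.filter_subset _ _) fun g _ _ => by positivity) (by positivity)

end truncation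

/-! ### Hyperedges that are rarely found -/

section dichotomy

open NamedHypergraph

variable {V E : Type*} [Fintype V] [DecidableEq V] [Fintype E] [DecidableEq E]

/-- Let `σ` separate the vertex `u` of a rarely found hyperedge `e` from half of the vertices of
`e`.  Either the spread energy of `σ` is large, or the pairs at `u`, weighted with the probabilities
of finding their hyperedges at `u`, carry a large energy.

Since `e` is rarely found, the expected energy of every truncation of `σ` is large.  If it is not
due to the spread energy, it is due to the star at `u`; a level is chosen at which the star energy
drops at most by a constant factor to the next level.  The number `N` of the hyperedges at `u` that
reach beyond the next level is then comparable with the total energy, so that each of them is found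
at `u` with a probability of order `1 / N`. -/
theorem spread_or_star_of_rarely_found {r : ℕ} (hr : 1 ≤ r) {vt : E → Finset V} {Y : Finset E}
    (hY : ∀ g ∈ Y, r ≤ (vt g).card ∧ (vt g).card ≤ 2 * r) {J : ℕ} (hJ : 2 * Y.card ≤ 2 ^ J)
    (hJ2 : 2 ≤ J) {e : E} (he : e ∈ Y) {u : V} (hu : u ∈ vt e) {σ : V → ℝ}
    (h1 : ∀ a, σ a ≤ 1) (hσu : σ u = 0)
    (hS : (vt e).card ≤ 2 * ((vt e).filter fun a => σ a = 1).card) {l : ℝ} (hl : 320 ≤ l)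
    (hq : catchProb r (ENNReal.ofReal l) ⟨Y, vt⟩ e < 1 / (8 * r)) :
    l * (1 / (40960 * (J : ℝ) ^ 2)) ≤ spreadEnergy r vt Y σ ∨
      l / (491520 * (J : ℝ) ^ 2 * r) ≤
        ∑ g ∈ Y with u ∈ vt g, starCatch r (ENNReal.ofReal l) ⟨Y, vt⟩ g u *
          ((r : ℝ)⁻¹ * ∑ b ∈ vt g, (σ u - σ b) ^ 2) := by
  refine or_iff_not_imp_left.2 fun hspread => ?_
  rw [not_le] at hspread
  have hr0 : (0 : ℝ) < r := by exact_mod_cast hr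
  have hJ0 : (2 : ℝ) ≤ J := by exact_mod_cast hJ2
  -- the distance of consecutive levels
  obtain ⟨d, hd⟩ : ∃ d : ℝ, d = 1 / (2 * J) := ⟨_, rfl⟩
  have hd0 : 0 < d := by rw [hd]; positivity
  have hd1 : d ≤ 1 / 4 := by
    rw [hd]
    exact one_div_le_one_div_of_le (by norm_num) (by linarith)
  have hJd : J * d = 1 / 2 := by
    rw [hd]
    field_simp
  have hdsq : 1 / (40960 * (J : ℝ) ^ 2) = d ^ 2 / 10240 := by
    rw [hd]
    field_simp
    norm_num
  have hgoal : l / (491520 * (J : ℝ) ^ 2 * r) = l * d ^ 2 / (122880 * r) := by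
    rw [hd]
    field_simp
    norm_num
  rw [hdsq] at hspread
  rw [hgoal]
  have hd2 : d ^ 2 ≤ 1 / 16 := by nlinarith
  have hl0 : 0 < l := by linarith
  have hspread' : spreadEnergy r vt Y σ < l / 640 := by
    have : l * (d ^ 2 / 10240) ≤ l / 640 := by nlinarith
    linarith
  obtain ⟨St, hSt⟩ : ∃ St : ℝ → ℝ, St = fun s => starEnergy r vt Y u (fun a => max (σ a) s) :=
    ⟨_, rfl⟩
  have hsp : ∀ s, spreadEnergy r vt Y (fun a => max (σ a) s) ≤ spreadEnergy r vt Y σ :=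
    fun s => spreadEnergy_max_le r vt Y σ s
  -- Otherwise the potential truncated at `3 / 4` would witness that `e` is found too often.
  have hstar1 : l / 320 < St (3 / 4) := by
    by_contra! hcon
    have h2 := le_starCatch hr (Y := Y) he (hY e he).2 hu
      (S := (vt e).filter fun a => σ a = 1) (Finset.filter_subset _ _) ((hY e he).1.trans hS)
      hl0.le (fun a => max (σ a) (3 / 4)) (δ := 1 / 4) (Φ := l / 160) (by norm_num) (by positivity)
      (fun b hb => by
        rw [hσu, (Finset.mem_filter.1 hb).2]
        norm_num)
      (by
        have := hsp (3 / 4)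
        rw [hSt] at hcon
        simp only at hcon
        linarith)
    have h3 : l * ((1 / 4) ^ 2 / (10 * (l / 160))) = 1 := by
      field_simp
      norm_num
    rw [h3, min_self, mul_one] at h2
    exact absurd (h2.trans (starCatch_le_catchProb _ _ _ _ _)) (not_le.2 hq)
  -- The star energy lies between `1` and `2 ^ J`, so it cannot halve at each of the `J` levels.
  obtain ⟨k, hkJ, hk⟩ : ∃ k < J, St (1 / 4 + (k : ℕ) * d) ≤ 2 * St (1 / 4 + (k + 1 : ℕ) * d) := by
    refine exists_le_two_mul_succ (f := fun k : ℕ => St (1 / 4 + k * d)) ?_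
    have h2 : St (1 / 4) ≤ 2 * Y.card := by
      rw [hSt]
      exact starEnergy_max_le hr (fun g hg => (hY g hg).2) h1 hσu (by norm_num) (by norm_num)
    have h3 : (2 * Y.card : ℝ) ≤ 2 ^ J := by exact_mod_cast hJ
    simp only [Nat.cast_zero, zero_mul, add_zero, hJd]
    rw [show (1 / 4 + 1 / 2 : ℝ) = 3 / 4 by norm_num]
    have h4 : (0 : ℝ) < 2 ^ J := by positivity
    have h5 : 1 < St (3 / 4) := by linarith
    nlinarith
  obtain ⟨s₀, hs₀⟩ : ∃ s₀ : ℝ, s₀ = 1 / 4 + k * d := ⟨_, rfl⟩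
  obtain ⟨s₁, hs₁⟩ : ∃ s₁ : ℝ, s₁ = s₀ + d := ⟨_, rfl⟩
  have hs₁' : 1 / 4 + (k + 1 : ℕ) * d = s₁ := by
    rw [hs₁, hs₀]
    push_cast
    ring
  rw [hs₁', ← hs₀] at hk
  have hs₀4 : 1 / 4 ≤ s₀ := by
    rw [hs₀]
    have : 0 ≤ k * d := by positivity
    linarith
  have hs₁4 : s₁ ≤ 3 / 4 := by
    rw [← hs₁']
    have : ((k + 1 : ℕ) : ℝ) * d ≤ J * d :=
      mul_le_mul_of_nonneg_right (by exact_mod_cast hkJ) hd0.le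
    linarith
  have hstar2 : l / 320 < St s₁ := by
    refine hstar1.trans_le ?_
    rw [hSt]
    exact starEnergy_max_anti hσu (by linarith) hs₁4
  -- the hyperedges at `u` in which half of the vertices lie beyond the middle of the two levels
  set G := (Y.filter fun g => u ∈ vt g).filter fun g =>
    (vt g).card ≤ 2 * ((vt g).filter fun b => s₀ + d / 2 ≤ σ b).card with hG
  have hcount : St s₁ ≤ 2 * G.card + 4 / (d / 2) ^ 2 * spreadEnergy r vt Y σ := by
    rw [hSt]
    exact starEnergy_max_le_card hr hY h1 hσu (by linarith) (by linarith) (by linarith)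
      (by rw [hs₁]; ring)
  have hN : St s₁ ≤ 4 * G.card := by
    have h2 : 4 / (d / 2) ^ 2 * spreadEnergy r vt Y σ ≤
        4 / (d / 2) ^ 2 * (l * (d ^ 2 / 10240)) :=
      mul_le_mul_of_nonneg_left hspread.le (by positivity)
    have h3 : 4 / (d / 2) ^ 2 * (l * (d ^ 2 / 10240)) = l / 640 := by
      field_simp
      norm_num
    linarith
  obtain ⟨N, hNdef⟩ : ∃ N : ℝ, N = G.card := ⟨_, rfl⟩
  rw [← hNdef] at hN
  have hN0 : l < 1280 * N := by linarith
  have hNpos : 0 < N := by linarith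
  have hcatch : ∀ g ∈ G, l * d ^ 2 / (3840 * r * N) ≤
      starCatch r (ENNReal.ofReal l) ⟨Y, vt⟩ g u := by
    intro g hg
    obtain ⟨hgY, hgood⟩ := Finset.mem_filter.1 hg
    obtain ⟨hgY, hug⟩ := Finset.mem_filter.1 hgY
    have h2 := le_starCatch hr (Y := Y) hgY (hY g hgY).2 hug
      (S := (vt g).filter fun b => s₀ + d / 2 ≤ σ b) (Finset.filter_subset _ _)
      ((hY g hgY).1.trans hgood)
      hl0.le (fun a => max (σ a) s₀) (δ := d / 2) (Φ := 12 * N) (by positivity) (by positivity)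
      (fun b hb => by
        have hb' := (Finset.mem_filter.1 hb).2
        rw [hσu, max_eq_right (by linarith), max_eq_left (by linarith), abs_sub_comm]
        exact le_trans (by linarith) (le_abs_self _))
      (by
        have h3 := hsp s₀
        have h4 : starEnergy r vt Y u (fun a => max (σ a) s₀) = St s₀ := by rw [hSt]
        rw [h4]
        linarith)
    have h3 : l * ((d / 2) ^ 2 / (10 * (12 * N))) = l * d ^ 2 / (480 * N) := by
      field_simp
      norm_num
    have h4 : l * d ^ 2 / (480 * N) ≤ 1 := by
      rw [div_le_one (by positivity)]
      nlinarith
    rw [h3, min_eq_right h4] at h2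
    refine le_trans (le_of_eq ?_) h2
    field_simp
    norm_num
  have hpair : ∀ g ∈ G, 1 / 32 ≤ (r : ℝ)⁻¹ * ∑ b ∈ vt g, (σ u - σ b) ^ 2 := by
    intro g hg
    obtain ⟨hgY, hgood⟩ := Finset.mem_filter.1 hg
    have hgr := (hY g (Finset.mem_filter.1 hgY).1).1
    exact le_inv_mul_sum_sq hr hσu (t := s₀ + d / 2) (by linarith) (hgr.trans hgood)
  calc l * d ^ 2 / (122880 * r) = ∑ g ∈ G, l * d ^ 2 / (3840 * r * N) * (1 / 32) := by
        rw [Finset.sum_const, nsmul_eq_mul, ← hNdef]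
        field_simp
        norm_num
    _ ≤ ∑ g ∈ G, starCatch r (ENNReal.ofReal l) ⟨Y, vt⟩ g u *
          ((r : ℝ)⁻¹ * ∑ b ∈ vt g, (σ u - σ b) ^ 2) :=
        Finset.sum_le_sum fun g hg => mul_le_mul (hcatch g hg) (hpair g hg) (by norm_num)
          (starCatch_nonneg _ _ _ _ _)
    _ ≤ _ := Finset.sum_le_sum_of_subset_of_nonneg (Finset.filter_subset _ _)
        fun g _ _ => mul_nonneg (starCatch_nonneg _ _ _ _ _) (by positivity)

end dichotomy

/-! ### The weight assignment -/

section weights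

open NamedHypergraph

variable {V E : Type*}

/-- The unnormalised weight of the pair `p` of vertices of the hyperedge `g`: a uniform part, and a
part that follows weights `A` on the vertices of `g`, each spread over the star of its vertex. -/
noncomputable def rawWeight (r : ℕ) (A : E → V → ℝ) (g : E) : Sym2 V → ℝ :=
  Sym2.lift ⟨fun a b => (r : ℝ)⁻¹ ^ 2 / 4 + (r : ℝ)⁻¹ * (A g a + A g b),
    fun a b => by simp only [add_comm (A g a)]⟩

theorem rawWeight_pos {r : ℕ} (hr : 1 ≤ r) {A : E → V → ℝ} (hA : ∀ g a, 0 ≤ A g a) (g : E)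
    (p : Sym2 V) : 0 < rawWeight r A g p := by
  have hr0 : (0 : ℝ) < r := by exact_mod_cast hr
  induction p using Sym2.ind with
  | _ a b =>
    have := hA g a
    have := hA g b
    simp only [rawWeight, Sym2.lift_mk]
    positivity

variable [DecidableEq V]

theorem sum_rawWeight_le_one {r : ℕ} (hr : 1 ≤ r) {A : E → V → ℝ} (hA : ∀ g a, 0 ≤ A g a) {g : E}
    {s : Finset V} (hs : s.card ≤ 2 * r) (hAs : ∑ a ∈ s, A g a ≤ 1 / 4) :
    ∑ p ∈ clique s, rawWeight r A g p ≤ 1 := by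
  have hr0 : (0 : ℝ) < r := by exact_mod_cast hr
  have hsr : (r : ℝ)⁻¹ * s.card ≤ 2 := by
    rw [inv_mul_le_iff₀ hr0, mul_comm]
    exact_mod_cast hs
  have h1 : 2 * ∑ p ∈ clique s, rawWeight r A g p ≤
      ∑ a ∈ s, ∑ b ∈ s, ((r : ℝ)⁻¹ ^ 2 / 4 + (r : ℝ)⁻¹ * (A g a + A g b)) := by
    rw [two_mul_sum_clique, ← Finset.sum_product']
    refine Finset.sum_le_sum_of_subset_of_nonneg (fun x hx => ?_) fun x _ _ => ?_
    · rw [Finset.mem_offDiag] at hx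
      exact Finset.mem_product.2 ⟨hx.1, hx.2.1⟩
    · exact (rawWeight_pos hr hA g s(x.1, x.2)).le
  have h2 : ∑ a ∈ s, ∑ b ∈ s, ((r : ℝ)⁻¹ ^ 2 / 4 + (r : ℝ)⁻¹ * (A g a + A g b)) =
      ((r : ℝ)⁻¹ * s.card) ^ 2 / 4 + 2 * ((r : ℝ)⁻¹ * s.card) * ∑ a ∈ s, A g a := by
    simp only [Finset.sum_add_distrib, ← Finset.mul_sum, Finset.sum_const, nsmul_eq_mul]
    ring
  have h3 : 0 ≤ (r : ℝ)⁻¹ * s.card := by positivity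
  have h4 : 0 ≤ ∑ a ∈ s, A g a := Finset.sum_nonneg fun a _ => hA g a
  rw [h2] at h1
  nlinarith

theorem sum_rawWeight_mul_sqDiff {r : ℕ} {A : E → V → ℝ} {g : E} (s : Finset V) (y : V → ℝ) :
    ∑ p ∈ clique s, rawWeight r A g p * sqDiff y p =
      1 / 4 * ((r : ℝ)⁻¹ ^ 2 / 2 * ∑ a ∈ s, ∑ b ∈ s, (y a - y b) ^ 2) +
        ∑ a ∈ s, A g a * ((r : ℝ)⁻¹ * ∑ b ∈ s, (y a - y b) ^ 2) := by
  have h1 := two_mul_sum_clique_of_diag s (fun p => rawWeight r A g p * sqDiff y p)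
    (fun a => by simp)
  have h2 : ∑ a ∈ s, ∑ b ∈ s, A g b * (y a - y b) ^ 2 =
      ∑ a ∈ s, ∑ b ∈ s, A g a * (y a - y b) ^ 2 := by
    rw [Finset.sum_comm]
    refine Finset.sum_congr rfl fun a _ => Finset.sum_congr rfl fun b _ => ?_
    rw [← neg_sub, neg_sq]
  have h3 : ∑ a ∈ s, ∑ b ∈ s, rawWeight r A g s(a, b) * sqDiff y s(a, b) =
      (r : ℝ)⁻¹ ^ 2 / 4 * (∑ a ∈ s, ∑ b ∈ s, (y a - y b) ^ 2) +
        (r : ℝ)⁻¹ * ((∑ a ∈ s, ∑ b ∈ s, A g a * (y a - y b) ^ 2) +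
          ∑ a ∈ s, ∑ b ∈ s, A g b * (y a - y b) ^ 2) := by
    simp only [Finset.mul_sum, ← Finset.sum_add_distrib]
    refine Finset.sum_congr rfl fun a _ => Finset.sum_congr rfl fun b _ => ?_
    simp only [rawWeight, Sym2.lift_mk, sqDiff_mk]
    ring
  have h4 : ∑ a ∈ s, A g a * ((r : ℝ)⁻¹ * ∑ b ∈ s, (y a - y b) ^ 2) =
      (r : ℝ)⁻¹ * ∑ a ∈ s, ∑ b ∈ s, A g a * (y a - y b) ^ 2 := by
    simp only [Finset.mul_sum]
    exact Finset.sum_congr rfl fun a _ => Finset.sum_congr rfl fun b _ => by ring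
  rw [h4]
  simp only [h3, h2] at h1
  linarith

variable [DecidableEq E]

/-- For vertex weights `A` of total at most `1 / 4` in every hyperedge there is a weight assignment
whose energy dominates both the spread energy and the star energies weighted with `A`. -/
theorem exists_weightAssignment {r : ℕ} (hr : 1 ≤ r) (H : NamedHypergraph V E)
    (hH : ∀ g ∈ H.edges, 2 ≤ (H.verts g).card ∧ (H.verts g).card ≤ 2 * r)
    {A : E → V → ℝ} (hA : ∀ g a, 0 ≤ A g a) (hAs : ∀ g ∈ H.edges, ∑ a ∈ H.verts g, A g a ≤ 1 / 4) :
    ∃ W : E × Sym2 V → ℝ≥0, H.IsWeightAssignment W ∧ ∀ (y : V → ℝ) (u : V),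
      1 / 4 * spreadEnergy r H.verts H.edges y +
        ∑ g ∈ H.edges with u ∈ H.verts g,
          A g u * ((r : ℝ)⁻¹ * ∑ b ∈ H.verts g, (y u - y b) ^ 2) ≤
      energy H.multigraph W y := by
  set tot : E → ℝ := fun g => ∑ p ∈ clique (H.verts g), rawWeight r A g p with htot
  have htot0 : ∀ g ∈ H.edges, 0 < tot g := by
    intro g hg
    obtain ⟨a, ha, b, hb, hab⟩ := Finset.one_lt_card.1 (hH g hg).1
    exact Finset.sum_pos (fun p _ => rawWeight_pos hr hA g p)
      ⟨s(a, b), mk_mem_clique.2 ⟨ha, hb, hab⟩⟩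
  have htot1 : ∀ g ∈ H.edges, tot g ≤ 1 := fun g hg =>
    sum_rawWeight_le_one hr hA (hH g hg).2 (hAs g hg)
  have hW : ∀ g ∈ H.edges, ∀ p, ((rawWeight r A g p / tot g).toNNReal : ℝ) =
      rawWeight r A g p / tot g := fun g hg p =>
    Real.coe_toNNReal _ (div_nonneg (rawWeight_pos hr hA g p).le (htot0 g hg).le)
  refine ⟨fun f => (rawWeight r A f.1 f.2 / tot f.1).toNNReal, fun g hg => ?_, fun y u => ?_⟩
  · rw [← NNReal.coe_inj]
    push_cast
    rw [Finset.sum_congr rfl fun p _ => hW g hg p, ← Finset.sum_div]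
    exact div_self (htot0 g hg).ne'
  · rw [energy_multigraph, spreadEnergy, Finset.mul_sum, Finset.sum_filter,
      ← Finset.sum_add_distrib]
    refine Finset.sum_le_sum fun g hg => ?_
    calc _ ≤ ∑ p ∈ clique (H.verts g), rawWeight r A g p * sqDiff y p := by
          rw [sum_rawWeight_mul_sqDiff]
          refine add_le_add le_rfl ?_
          have hn : ∀ a ∈ H.verts g,
              0 ≤ A g a * ((r : ℝ)⁻¹ * ∑ b ∈ H.verts g, (y a - y b) ^ 2) :=
            fun a _ => mul_nonneg (hA g a) (by positivity)
          split_ifs with hu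
          · exact Finset.single_le_sum
              (f := fun a => A g a * ((r : ℝ)⁻¹ * ∑ b ∈ H.verts g, (y a - y b) ^ 2)) hn hu
          · exact Finset.sum_nonneg hn
      _ ≤ _ := by
          refine Finset.sum_le_sum fun p _ => ?_
          refine mul_le_mul_of_nonneg_right ?_ (sqDiff_nonneg y p)
          simp only
          rw [hW g hg, le_div_iff₀ (htot0 g hg)]
          exact mul_le_of_le_one_right (rawWeight_pos hr hA g p).le (htot1 g hg)

end weights

/-! ### Resistances from potentials that separate a vertex from half of a hyperedge -/

/-- A potential that separates two vertices of `s` can be rescaled and truncated so that it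
separates one of them from at least half of the vertices of `s`. -/
theorem effRes_le_of_half_separated {V E : Type*} {G : Finset (E × Sym2 V)}
    {W : E × Sym2 V → ℝ≥0} {s : Finset V} {θ : ℝ} (hθ : 0 < θ)
    (h : ∀ u ∈ s, ∀ σ : V → ℝ, (∀ a, σ a ≤ 1) → σ u = 0 →
      s.card ≤ 2 * (s.filter fun a => σ a = 1).card → 4 / θ ≤ energy G W σ)
    {u v : V} (hu : u ∈ s) (hv : v ∈ s) : effRes G W u v ≤ ENNReal.ofReal θ := by
  refine effRes_le_ofReal hθ fun x hxu hxv => ?_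
  have hcontr : ∀ z : V → ℝ, (∀ a b, |z a - z b| = 2 * |x a - x b|) → ∀ w ∈ s, z w = 0 →
      s.card ≤ 2 * (s.filter fun a => 1 ≤ z a).card → θ⁻¹ ≤ energy G W x := by
    intro z hz w hw hzw hcard
    have h1 := h w hw (fun a => min (z a) 1) (fun a => min_le_right _ _) (by simp [hzw])
      (by simpa using hcard)
    have h2 := energy_le_of_contracts G W (x := fun a => min (z a) 1) (y := x) (c := 2)
      fun a b => (abs_min_sub_min_le_max _ _ _ _).trans (by
        rw [sub_self, abs_zero, max_eq_left (abs_nonneg _)]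
        exact (hz a b).le)
    have h3 : 4 / θ = 4 * θ⁻¹ := div_eq_mul_inv _ _
    linarith
  have hsplit := Finset.card_filter_add_card_filter_not (s := s) fun a => x a ≤ 1 / 2
  by_cases hc : s.card ≤ 2 * (s.filter fun a => x a ≤ 1 / 2).card
  · refine hcontr (fun a => 2 * (1 - x a)) (fun a b => ?_) u hu (by simp [hxu]) ?_
    · rw [← mul_sub, abs_mul, abs_two, abs_sub_comm, sub_sub_sub_cancel_left, abs_sub_comm,
        abs_sub_comm (x b)]
    · refine hc.trans (Nat.mul_le_mul_left 2 (Finset.card_le_card ?_))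
      intro a ha
      rw [Finset.mem_filter] at ha ⊢
      exact ⟨ha.1, by linarith [ha.2]⟩
  · refine hcontr (fun a => 2 * x a) (fun a b => ?_) v hv (by simp [hxv]) ?_
    · rw [← mul_sub, abs_mul, abs_two]
    · have h1 : (s.filter fun a => ¬ x a ≤ 1 / 2).card ≤ (s.filter fun a => 1 ≤ 2 * x a).card := by
        refine Finset.card_le_card fun a ha => ?_
        rw [Finset.mem_filter] at ha ⊢
        exact ⟨ha.1, by linarith [not_le.1 ha.2]⟩
      omega

/-! ### Hyperedges that outlive the schedule -/

section survivors

open NamedHypergraph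

variable {V E : Type*} [Fintype V] [DecidableEq V] [Fintype E] [DecidableEq E]

/-- A nonnegative sequence that is at least `κ` whenever `q t < ε` has a large sum, provided that
the sum of `q` is so small that `q t < ε` holds at least half of the time. -/
theorem half_mul_le_sum {T : ℕ} {q F : ℕ → ℝ} {ε κ : ℝ} (hε : 0 < ε) (hκ : 0 ≤ κ)
    (hq0 : ∀ t, 0 ≤ q t) (hF0 : ∀ t, 0 ≤ F t) (hq : ∑ t ∈ Finset.range T, q t ≤ ε * (T / 2))
    (hF : ∀ t < T, q t < ε → κ ≤ F t) : T / 2 * κ ≤ ∑ t ∈ Finset.range T, F t := by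
  have h1 : ∀ t ∈ Finset.range T, κ ≤ F t + κ / ε * q t := by
    intro t ht
    by_cases h : q t < ε
    · have := hF t (Finset.mem_range.1 ht) h
      have h2 : 0 ≤ κ / ε * q t := mul_nonneg (div_nonneg hκ hε.le) (hq0 t)
      linarith
    · have h2 : κ / ε * ε ≤ κ / ε * q t :=
        mul_le_mul_of_nonneg_left (not_lt.1 h) (div_nonneg hκ hε.le)
      rw [div_mul_cancel₀ _ hε.ne'] at h2
      linarith [hF0 t]
  have h2 := Finset.sum_le_sum h1
  rw [Finset.sum_const, Finset.card_range, nsmul_eq_mul, Finset.sum_add_distrib,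
    ← Finset.mul_sum] at h2
  have h3 : κ / ε * ∑ t ∈ Finset.range T, q t ≤ κ / ε * (ε * (T / 2)) :=
    mul_le_mul_of_nonneg_left hq (div_nonneg hκ hε.le)
  have h4 : κ / ε * (ε * (T / 2)) = T / 2 * κ := by
    field_simp
  linarith

/-- Some weight assignment gives every potential that separates a vertex of a hyperedge `e` from
half of `e` a large energy, simultaneously for all the hyperedges `e` that outlive the schedule.
The vertex weights are proportional to the probabilities, accumulated over the schedule, of finding
a hyperedge at one of its vertices. -/
theorem exists_weightAssignment_of_alive {r : ℕ} (hr : 1 ≤ r) {H : NamedHypergraph V E}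
    (hH : ∀ e ∈ H.edges, 2 ≤ (H.verts e).card ∧
      r ≤ (H.verts e).card ∧ (H.verts e).card ≤ 2 * r) {J : ℕ} (hJ : 2 * H.edges.card ≤ 2 ^ J)
    (hJ2 : 2 ≤ J) {θ p L : ℝ} (hθ : 0 < θ) (hθ1 : θ < 1) (hL : 0 ≤ L)
    (hpJ : 655360 * (J : ℝ) ^ 2 ≤ p) (hpL : 720 * (L + 1) ≤ p) :
    ∃ W : E × Sym2 V → ℝ≥0, H.IsWeightAssignment W ∧
      ∀ e ∈ alive r (ENNReal.ofReal (θ⁻¹ * p)) L H (r * ⌈p⌉₊), ∀ u ∈ H.verts e, ∀ σ : V → ℝ,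
        (∀ a, σ a ≤ 1) → σ u = 0 →
        (H.verts e).card ≤ 2 * ((H.verts e).filter fun a => σ a = 1).card →
        4 / θ ≤ energy H.multigraph W σ := by
  set l := θ⁻¹ * p with hl
  set lam := ENNReal.ofReal l with hlam
  set T := r * ⌈p⌉₊ with hT
  have hr0 : (0 : ℝ) < r := by exact_mod_cast hr
  have hJ0 : (2 : ℝ) ≤ J := by exact_mod_cast hJ2
  have hp : 0 < p := by linarith
  have hp320 : 320 ≤ p := by nlinarith
  have hTp : r * p ≤ (T : ℝ) := by
    rw [hT]
    push_cast
    exact mul_le_mul_of_nonneg_left (Nat.le_ceil p) hr0.le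
  have hl320 : 320 ≤ l := by
    have h1 : 1 ≤ θ⁻¹ := (one_le_inv₀ hθ).2 hθ1.le
    rw [hl]
    nlinarith
  set A : E → V → ℝ := fun g u =>
    (∑ t ∈ Finset.range T, starCatch r lam ⟨alive r lam L H t, H.verts⟩ g u) / (120 * (L + 1))
    with hA
  have hA0 : ∀ g a, 0 ≤ A g a := fun g a =>
    div_nonneg (Finset.sum_nonneg fun t _ => starCatch_nonneg _ _ _ _ _) (by linarith)
  have hAs : ∀ g ∈ H.edges, ∑ a ∈ H.verts g, A g a ≤ 1 / 4 := by
    intro g _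
    rw [hA]
    simp only
    rw [← Finset.sum_div, Finset.sum_comm, div_le_iff₀ (by linarith)]
    calc _ ≤ ∑ t ∈ Finset.range T, 30 * catchProb r lam ⟨alive r lam L H t, H.verts⟩ g :=
          Finset.sum_le_sum fun t _ => sum_starCatch_le r lam ⟨alive r lam L H t, H.verts⟩ g
      _ = 30 * exposure r lam L H T g := by rw [← Finset.mul_sum, exposure_eq_sum]
      _ ≤ 30 * (L + 1) := mul_le_mul_of_nonneg_left (exposure_le hL T g) (by norm_num)
      _ = 1 / 4 * (120 * (L + 1)) := by ring
  obtain ⟨W, hW, hWE⟩ := exists_weightAssignment hr H (fun g hg => ⟨(hH g hg).1, (hH g hg).2.2⟩)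
    hA0 hAs
  refine ⟨W, hW, fun e he u hu σ h1 hσu hS => ?_⟩
  refine le_trans ?_ (hWE σ u)
  obtain ⟨heH, heL⟩ := Finset.mem_filter.1 he
  have hstar0 : ∀ (B : E → V → ℝ), (∀ g a, 0 ≤ B g a) → 0 ≤ ∑ g ∈ H.edges with u ∈ H.verts g,
      B g u * ((r : ℝ)⁻¹ * ∑ b ∈ H.verts g, (σ u - σ b) ^ 2) := fun B hB =>
    Finset.sum_nonneg fun g _ => mul_nonneg (hB g u) (by positivity)
  by_cases hspread : l * (1 / (40960 * (J : ℝ) ^ 2)) ≤ spreadEnergy r H.verts H.edges σ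
  · have h2 : 4 / θ ≤ 1 / 4 * (l * (1 / (40960 * (J : ℝ) ^ 2))) := by
      rw [hl, div_le_iff₀ hθ]
      have h3 : 1 / 4 * (θ⁻¹ * p * (1 / (40960 * (J : ℝ) ^ 2))) * θ =
          p / (163840 * (J : ℝ) ^ 2) := by
        field_simp
        norm_num
      rw [h3, le_div_iff₀ (by positivity)]
      linarith
    have h3 := hstar0 A hA0
    linarith
  · set κ := l / (491520 * (J : ℝ) ^ 2 * r) with hκ
    have hκ0 : 0 ≤ κ := by positivity
    have hround := half_mul_le_sum (T := T) (ε := 1 / (8 * r)) (κ := κ)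
      (q := fun t => catchProb r lam ⟨alive r lam L H t, H.verts⟩ e)
      (F := fun t => ∑ g ∈ H.edges with u ∈ H.verts g,
        starCatch r lam ⟨alive r lam L H t, H.verts⟩ g u *
          ((r : ℝ)⁻¹ * ∑ b ∈ H.verts g, (σ u - σ b) ^ 2))
      (by positivity) hκ0 (fun t => catchProb_nonneg _ _ _ _)
      (fun t => hstar0 _ fun g a => starCatch_nonneg _ _ _ _ _)
      (by
        rw [← exposure_eq_sum]
        refine heL.le.trans ?_
        have h2 : 1 / (8 * (r : ℝ)) * (T / 2) = T / r / 16 := by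
          field_simp
          ring
        rw [h2, le_div_iff₀ (by norm_num), le_div_iff₀ hr0]
        nlinarith)
      (fun t ht hq => by
        have het : e ∈ alive r lam L H t := by
          refine Finset.mem_filter.2 ⟨heH, lt_of_le_of_lt ?_ heL⟩
          rw [exposure_eq_sum, exposure_eq_sum]
          exact Finset.sum_le_sum_of_subset_of_nonneg (Finset.range_mono ht.le)
            fun s _ _ => catchProb_nonneg _ _ _ _
        have hsub := alive_subset (r := r) (lam := lam) (L := L) (H := H) t
        have hcard := Finset.card_le_card hsub
        have h2 := spread_or_star_of_rarely_found hr (vt := H.verts) (Y := alive r lam L H t)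
          (fun g hg => (hH g (hsub hg)).2) (J := J) (by omega) hJ2 het hu h1 hσu hS hl320 hq
        rcases h2 with h2 | h2
        · refine absurd (h2.trans ?_) hspread
          exact Finset.sum_le_sum_of_subset_of_nonneg hsub fun g _ _ => by positivity
        · refine h2.trans (Finset.sum_le_sum_of_subset_of_nonneg
            (Finset.filter_subset_filter _ hsub) fun g _ _ => ?_)
          exact mul_nonneg (starCatch_nonneg _ _ _ _ _) (by positivity))
    have hsum : ∑ g ∈ H.edges with u ∈ H.verts g,
        A g u * ((r : ℝ)⁻¹ * ∑ b ∈ H.verts g, (σ u - σ b) ^ 2) =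
        (∑ t ∈ Finset.range T, ∑ g ∈ H.edges with u ∈ H.verts g,
          starCatch r lam ⟨alive r lam L H t, H.verts⟩ g u *
            ((r : ℝ)⁻¹ * ∑ b ∈ H.verts g, (σ u - σ b) ^ 2)) / (120 * (L + 1)) := by
      rw [Finset.sum_comm, Finset.sum_div]
      refine Finset.sum_congr rfl fun g _ => ?_
      rw [← Finset.sum_mul, hA]
      ring
    rw [hsum]
    have h2 : 4 / θ ≤ T / 2 * κ / (120 * (L + 1)) := by
      have h4 : r * p / 2 * κ = p * (θ⁻¹ * p) / (983040 * (J : ℝ) ^ 2) := by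
        rw [hκ, hl]
        field_simp
        norm_num
      have h5 : 4 / θ ≤ r * p / 2 * κ / (120 * (L + 1)) := by
        rw [h4, div_div, le_div_iff₀ (by positivity), div_mul_eq_mul_div, div_le_iff₀ hθ]
        have h6 : p * (θ⁻¹ * p) * θ = p * p := by
          field_simp
        rw [h6]
        have h7 : 655360 * (J : ℝ) ^ 2 * (720 * (L + 1)) ≤ p * p :=
          mul_le_mul hpJ hpL (by positivity) hp.le
        linarith
      refine h5.trans ?_
      gcongr
    have h3 := spreadEnergy_nonneg r H.verts H.edges σ
    have h8 := div_le_div_of_nonneg_right hround (by linarith : 0 ≤ 120 * (L + 1))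
    linarith

end survivors

theorem mainTheorem1 (c : ℕ) :
    ∃ C : ℝ, 0 < C ∧ ∃ K : ℕ,
      ∀ (V E : Type*) [Fintype V] [DecidableEq V] [Fintype E] [DecidableEq E]
        (θ : ℝ) (r n m : ℕ) (H : NamedHypergraph V E),
        0 < θ → θ < 1 →
        1 ≤ r → n = Fintype.card V → H.edges.card ≤ m →
        (∀ e ∈ H.edges, 2 ≤ (H.verts e).card ∧
          r ≤ (H.verts e).card ∧ (H.verts e).card ≤ 2 * r) →
        ∃ W : E × Sym2 V → ℝ≥0, H.IsWeightAssignment W ∧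
          ∀ e ∈ H.edges,
            (∀ u ∈ H.verts e, ∀ v ∈ H.verts e,
              effRes H.multigraph W u v ≤ ENNReal.ofReal θ) ∨
            1 - 1 / ((n : ℝ) * m) ^ c ≤
              ((vertexSampling r (ENNReal.ofReal (θ⁻¹ * polylog C K n m))
                (r * ⌈polylog C K n m⌉₊) H).toOuterMeasure {F | e ∈ F}).toReal := by
  -- `16384000 = 655360 * 5 ^ 2`, where `655360 J ^ 2 ≤ p` is needed for `J ≤ 5 log (n m)` levels.
  refine ⟨16384000 * (c + 1), by positivity, 2, ?_⟩
  intro V E _ _ _ _ θ r n m H hθ hθ1 hr hn hm hH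
  rcases H.edges.eq_empty_or_nonempty with hE | ⟨e₀, he₀⟩
  · exact ⟨0, fun e he => by simp [hE] at he, fun e he => by simp [hE] at he⟩
  have hm1 : 1 ≤ m := (Finset.card_pos.2 ⟨e₀, he₀⟩).trans_le hm
  have hn2 : 2 ≤ n := by
    rw [hn]
    exact (hH e₀ he₀).1.trans (Finset.card_le_univ _)
  have hm0 : (1 : ℝ) ≤ m := by exact_mod_cast hm1
  have hn0 : (2 : ℝ) ≤ n := by exact_mod_cast hn2
  have hlog2 := Real.log_two_gt_d9
  set ℓ := Real.log ((n : ℝ) * m) with hℓ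
  have hℓ2 : Real.log 2 ≤ ℓ := Real.log_le_log (by norm_num) (by nlinarith)
  have hℓm : Real.log m ≤ ℓ := Real.log_le_log (by linarith) (by nlinarith)
  set p := polylog (16384000 * (c + 1)) 2 n m with hp
  have hpℓ : p = 16384000 * (c + 1) * ℓ ^ 2 := rfl
  have hc : (0 : ℝ) ≤ c := Nat.cast_nonneg c
  set L : ℝ := (c + 1) * ℓ with hL
  have hL0 : 0 ≤ L := mul_nonneg (by linarith) (by linarith)
  set J := Nat.log 2 m + 2 with hJ
  have hJpow : 2 * H.edges.card ≤ 2 ^ J := by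
    have h1 := Nat.lt_pow_succ_log_self (b := 2) (by norm_num) m
    rw [hJ, pow_succ]
    rw [Nat.succ_eq_add_one] at h1
    have h2 : 2 ^ (Nat.log 2 m + 1) * 2 = 2 * 2 ^ (Nat.log 2 m + 1) := mul_comm _ _
    omega
  have hJℓ : (J : ℝ) ≤ 5 * ℓ := by
    have h1 : (2 : ℝ) ^ Nat.log 2 m ≤ m := by
      exact_mod_cast Nat.pow_log_le_self 2 (by omega : m ≠ 0)
    have h2 := Real.log_le_log (by positivity) h1
    rw [Real.log_pow] at h2
    have h3 : (J : ℝ) = Nat.log 2 m + 2 := by rw [hJ]; push_cast; ring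
    rw [h3]
    have h4 : (0 : ℝ) ≤ Nat.log 2 m := Nat.cast_nonneg _
    nlinarith
  have hpJ : 655360 * (J : ℝ) ^ 2 ≤ p := by
    have h1 : (J : ℝ) ^ 2 ≤ (5 * ℓ) ^ 2 := pow_le_pow_left₀ (Nat.cast_nonneg _) hJℓ 2
    rw [hpℓ]
    nlinarith [mul_nonneg hc (sq_nonneg ℓ)]
  have hpL : 720 * (L + 1) ≤ p := by
    have h1 : 1 ≤ 2 * ℓ := by linarith
    have h2 : L + 1 ≤ (c + 3) * ℓ := by rw [hL]; nlinarith
    have h3 : (c + 3) * ℓ ≤ (c + 3) * ℓ * (2 * ℓ) :=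
      le_mul_of_one_le_right (mul_nonneg (by linarith) (by linarith)) h1
    rw [hpℓ]
    nlinarith [mul_nonneg hc (sq_nonneg ℓ), sq_nonneg ℓ]
  obtain ⟨W, hW, hWE⟩ := exists_weightAssignment_of_alive hr hH hJpow (by omega) hθ hθ1 hL0 hpJ hpL
  refine ⟨W, hW, fun e he => or_iff_not_imp_left.2 fun hne => ?_⟩
  have hdead : e ∉ alive r (ENNReal.ofReal (θ⁻¹ * p)) L H (r * ⌈p⌉₊) := fun h =>
    hne fun u hu v hv => effRes_le_of_half_separated hθ (fun w hw => hWE e h w hw) hu hv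
  refine le_trans (sub_le_sub_left ?_ 1) (le_prob_found he hdead)
  have hnm : (0 : ℝ) < n * m := by nlinarith
  have hexp : Real.exp (-L) = (((n : ℝ) * m) ^ (c + 1))⁻¹ := by
    rw [Real.exp_neg, hL, hℓ, ← Nat.cast_add_one, Real.exp_nat_mul, Real.exp_log hnm]
  rw [hexp, ← div_eq_mul_inv, div_le_div_iff₀ (by positivity) (by positivity), one_mul, pow_succ,
    mul_comm]
  refine mul_le_mul_of_nonneg_left ?_ (by positivity)
  have h1 : (H.edges.card : ℝ) ≤ m := by exact_mod_cast hm
  nlinarith
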